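/- Let $E$ be an algebraically closed field of characteristic zero, let $G$ be a connected linear algebraic group over $E$, i.e. a Zariski closed connected subgroup of some $\mathrm{GL}_m(E)$, and for a closed subgroup $H$ of $G$ let $X(H)$ denote the group of rational characters of $H$, i.e. of homomorphisms $H\to E^\times$ that are regular functions. Let $V=\mathbb A^n(E)$ be a prehomogeneous affine space under $G$, i.e. an affine space with a regular action $G\times V\to V$ (not necessarily linear or affine) which has a dense orbit $V^{\mathrm{gen}}$. Points of $V^{\mathrm{gen}}$ are called generic, and $V\setminus V^{\mathrm{gen}}$ is called the singular set. A relative invariant of $V$ is a nonzero rational function $f$ on $V$ for which there is a $\chi\in X(G)$ with $f(gx)=\chi(g)f(x)$ for all $g\in G$ and $x\in V$ (as rational functions of $x$). We say that $V$ is special if the restriction map $X(G)\to X(G^\xi)$ is an isomorphism for some $\xi\in V^{\mathrm{gen}}$, where $G^\xi$ is the stabiliser of $\xi$. Then $V$ is special if and only if $X(G)\to X(G^\xi)$ is an isomorphism for every $\xi\in V^{\mathrm{gen}}$ (equivalently, for any given one), and the following conditions are equivalent: (i) $V$ is special; (ii) the singular set has codimension larger than one in $V$ (the empty set having codimension $\infty$);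 (iii) all relative invariants of $V$ are constant. -/

import Mathlib

namespace Prehomogeneous

/-- The Zariski topology on the set `σ → E` of points of an affine space: the closed sets are the
zero loci of ideals of polynomials. -/
@[reducible]
noncomputable def zariski (E σ : Type*) [Field E] : TopologicalSpace (σ → E) :=
  TopologicalSpace.induced
    (MvPolynomial.pointToPoint : (σ → E) → PrimeSpectrum (MvPolynomial σ E)) inferInstance

/-- The codimension of `S` in affine space: the infimum, over the irreducible closed `Z ⊆ S`, of
the supremum of the lengths of chains of irreducible closed sets starting from `Z`. The empty set
has codimension `⊤`. -/
noncomputable def codim {E σ : Type*} [Field E] (S : Set (σ → E)) : ℕ∞ :=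
  letI := zariski E σ
  ⨅ (Z : TopologicalSpace.IrreducibleCloseds (σ → E)) (_ : (Z : Set (σ → E)) ⊆ S), Order.coheight Z

section Groups

variable {E : Type*} [Field E] {m : ℕ}

/-- The coordinates on `GL_m`: the matrix entries, and (at `none`) the inverse of the
determinant. They embed `GL_m` as a closed subset of an affine space. -/
def glCoord (g : GL (Fin m) E) : Option (Fin m × Fin m) → E
  | none => (g : Matrix (Fin m) (Fin m) E).det⁻¹
  | some p => (g : Matrix (Fin m) (Fin m) E) p.1 p.2

/-- The Zariski topology on `GL_m`. -/
@[reducible]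
noncomputable def glZariski (E : Type*) [Field E] (m : ℕ) : TopologicalSpace (GL (Fin m) E) :=
  TopologicalSpace.induced glCoord (zariski E (Option (Fin m × Fin m)))

/-- A connected linear algebraic group: a Zariski closed and connected subgroup of `GL_m`. -/
structure IsConnectedLinearAlgebraicGroup (G : Subgroup (GL (Fin m) E)) : Prop where
  isClosed : @IsClosed _ (glZariski E m) (G : Set (GL (Fin m) E))
  isConnected : @IsConnected _ (glZariski E m) (G : Set (GL (Fin m) E))

/-- Regular functions on a (closed) subgroup of `GL_m`: restrictions of polynomials in the
matrix entries and the inverse of the determinant. -/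
def IsRegular {H : Subgroup (GL (Fin m) E)} (f : H → E) : Prop :=
  ∃ P : MvPolynomial (Option (Fin m × Fin m)) E, ∀ h : H, f h = MvPolynomial.eval (glCoord h.1) P

theorem isRegular_comp_inv {H : Subgroup (GL (Fin m) E)} {f : H → E} (hf : IsRegular f) :
    IsRegular fun h => f h⁻¹ := by
  obtain ⟨P, hP⟩ := hf
  let X : Matrix (Fin m) (Fin m) (MvPolynomial (Option (Fin m × Fin m)) E) :=
    Matrix.of fun i j => MvPolynomial.X (some (i, j))
  let Q : Option (Fin m × Fin m) → MvPolynomial (Option (Fin m × Fin m)) E := fun o =>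
    match o with
    | none => X.det
    | some p => MvPolynomial.X none * X.adjugate p.1 p.2
  refine ⟨MvPolynomial.bind₁ Q P, fun h => ?_⟩
  have hX : (MvPolynomial.eval (glCoord h.1)).mapMatrix X = (h.1 : Matrix (Fin m) (Fin m) E) := by
    ext i j
    simp [X, glCoord]
  have hQ : (fun o => MvPolynomial.eval (glCoord h.1) (Q o)) = glCoord (h⁻¹).1 := by
    funext o
    match o with
    | none =>
      simp only [Q, RingHom.map_det, hX]
      simp [glCoord, Matrix.coe_units_inv, Matrix.det_nonsing_inv, Ring.inverse_eq_inv']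
    | some p =>
      have hadj : MvPolynomial.eval (glCoord h.1) (X.adjugate p.1 p.2)
          = (h.1 : Matrix (Fin m) (Fin m) E).adjugate p.1 p.2 := by
        rw [← hX, ← RingHom.map_adjugate]
        rfl
      simp only [Q, map_mul, hadj]
      simp [glCoord, Matrix.coe_units_inv, Matrix.inv_def, Ring.inverse_eq_inv']
  change f h⁻¹ = _
  rw [hP, ← hQ]
  exact (MvPolynomial.eval₂Hom_bind₁ _ _ _ _).symm

/-- The group `X(H)` of rational characters: the homomorphisms from `H` to `GL(1)` which are
regular functions. -/
def characterGroup (H : Subgroup (GL (Fin m) E)) : Subgroup (H →* Eˣ) where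
  carrier := {χ | IsRegular fun h => (χ h : E)}
  one_mem' := ⟨1, fun h => by simp⟩
  mul_mem' := by
    rintro χ ψ ⟨P, hP⟩ ⟨Q, hQ⟩
    exact ⟨P * Q, fun h => by simp [hP, hQ]⟩
  inv_mem' := by
    intro χ hχ
    have h := isRegular_comp_inv hχ
    simp only [map_inv] at h
    exact h

/-- The restriction map `X(G) → X(H)` for `H ≤ G`. -/
def restrict {H G : Subgroup (GL (Fin m) E)} (hHG : H ≤ G) :
    characterGroup G →* characterGroup H where
  toFun χ := ⟨χ.1.comp (Subgroup.inclusion hHG), by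
    obtain ⟨P, hP⟩ := χ.2
    exact ⟨P, fun h => hP (Subgroup.inclusion hHG h)⟩⟩
  map_one' := rfl
  map_mul' _ _ := rfl

end Groups

section Actions

variable {E : Type*} [Field E] {m n : ℕ} (G : Subgroup (GL (Fin m) E))
  [MulAction G (Fin n → E)]

/-- The action map `G × V → V` is a morphism of varieties, where `V` is affine `n`-space. -/
def IsRegularAction : Prop :=
  ∃ F : Fin n → MvPolynomial (Option (Fin m × Fin m) ⊕ Fin n) E,
    ∀ (g : G) (x : Fin n → E) (i : Fin n),
      (g • x) i = MvPolynomial.eval (Sum.elim (glCoord g.1) x) (F i)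

/-- The generic points: those with a dense orbit. -/
def genericPoints : Set (Fin n → E) :=
  {ξ | @Dense _ (zariski E (Fin n)) (MulAction.orbit G ξ)}

/-- The stabiliser of `ξ` in `G`, as a subgroup of `GL_m`. -/
def stab (ξ : Fin n → E) : Subgroup (GL (Fin m) E) :=
  (MulAction.stabilizer G ξ).map G.subtype

theorem stab_le (ξ : Fin n → E) : stab G ξ ≤ G :=
  Subgroup.map_subtype_le _

variable (n) in
/-- Affine `n`-space is a prehomogeneous affine space under `G`: the action is regular and there
is a dense orbit. -/
structure IsPrehomogeneousAffineSpace : Prop where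
  isRegularAction : IsRegularAction (n := n) G
  nonempty : (genericPoints (n := n) G).Nonempty

variable (n) in
/-- The space is special: `X(G) → X(G^ξ)` is an isomorphism for some generic point `ξ`. -/
def IsSpecial : Prop :=
  ∃ ξ ∈ genericPoints (n := n) G, Function.Bijective (restrict (stab_le G ξ))

end Actions

section RationalFunctions

variable {E : Type*} [Field E] {m n : ℕ}

/-- The field of rational functions on affine `n`-space. -/
abbrev RationalFunctions (E : Type*) [Field E] (n : ℕ) : Type _ :=
  FractionRing (MvPolynomial (Fin n) E)

/-- The rational function `f` is defined at `x`, with value `c`. -/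
def HasValueAt (f : RationalFunctions E n) (x : Fin n → E) (c : E) : Prop :=
  ∃ p q : MvPolynomial (Fin n) E, MvPolynomial.eval x q ≠ 0 ∧
    f = algebraMap _ (RationalFunctions E n) p / algebraMap _ (RationalFunctions E n) q ∧
    c = MvPolynomial.eval x p / MvPolynomial.eval x q

/-- A relative invariant: a nonzero rational function `f` for which there is a rational character
`χ` such that `f (g x) = χ(g) f(x)` for all `g` and `x`, whenever both sides are defined. -/
def IsRelativeInvariant (G : Subgroup (GL (Fin m) E)) [MulAction G (Fin n → E)]
    (f : RationalFunctions E n) : Prop :=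
  f ≠ 0 ∧ ∃ χ ∈ characterGroup G, ∀ (g : G) (x : Fin n → E) (a b : E),
    HasValueAt f x a → HasValueAt f (g • x) b → b = (χ g : E) * a

end RationalFunctions

end Prehomogeneous

section CommutativeAlgebra

open scoped TensorProduct
open Polynomial

/-- A proper ideal of a finitely generated algebra over an algebraically closed field has a
rational zero. -/
theorem exists_algHom_le_ker {E R : Type*} [Field E] [IsAlgClosed E] [CommRing R] [Algebra E R]
    [Algebra.FiniteType E R] {I : Ideal R} (hI : I ≠ ⊤) :
    ∃ ψ : R →ₐ[E] E, I ≤ RingHom.ker ψ := by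
  obtain ⟨M, hM, hIM⟩ := Ideal.exists_le_maximal I hI
  let : Field (R ⧸ M) := Ideal.Quotient.field M
  have : Algebra.FiniteType E (R ⧸ M) :=
    Algebra.FiniteType.of_surjective (Ideal.Quotient.mkₐ E M) (Ideal.Quotient.mkₐ_surjective E M)
  have : Module.Finite E (R ⧸ M) := finite_of_finite_type_of_isJacobsonRing E (R ⧸ M)
  let e : E ≃ₐ[E] (R ⧸ M) := AlgEquiv.ofBijective (Algebra.ofId E (R ⧸ M))
    IsAlgClosed.algebraMap_bijective_of_isIntegral
  refine ⟨e.symm.toAlgHom.comp (Ideal.Quotient.mkₐ E M), fun x hx => ?_⟩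
  have h0 : Ideal.Quotient.mk M x = 0 := Ideal.Quotient.eq_zero_iff_mem.mpr (hIM hx)
  simp [RingHom.mem_ker, h0]

/-- An element of a finitely generated algebra over an algebraically closed field which vanishes
at all rational points is nilpotent. -/
theorem isNilpotent_of_forall_algHom {E R : Type*} [Field E] [IsAlgClosed E] [CommRing R]
    [Algebra E R] [Algebra.FiniteType E R] {x : R} (hx : ∀ ψ : R →ₐ[E] E, ψ x = 0) :
    IsNilpotent x := by
  have : IsJacobsonRing R := isJacobsonRing_of_finiteType (A := E)
  rw [← mem_nilradical, nilradical, Ideal.radical_eq_jacobson, Ideal.jacobson,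
    Submodule.mem_sInf]
  rintro M ⟨-, hM⟩
  obtain ⟨ψ, hψ⟩ := exists_algHom_le_ker (E := E) hM.ne_top
  have : M = RingHom.ker ψ := hM.eq_of_le (RingHom.ker_ne_top _) hψ
  rw [this]
  exact hx ψ

/-- In characteristic zero, an element `u` of a field extension with `u ⊗ 1 - 1 ⊗ u` nilpotent
lies in the base field. -/
theorem mem_range_algebraMap_of_isNilpotent_tmul_sub {K L : Type*} [Field K] [CharZero K] [Field L]
    [Algebra K L] {u : L} (hu : IsNilpotent (u ⊗ₜ[K] (1 : L) - (1 : L) ⊗ₜ[K] u)) :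
    u ∈ (algebraMap K L).range := by
  let S : Subalgebra K L := Algebra.adjoin K {u}
  let v : S := ⟨u, Algebra.self_mem_adjoin_singleton K u⟩
  have hinj : Function.Injective (Algebra.TensorProduct.map S.val S.val) :=
    TensorProduct.map_injective_of_flat_flat S.val.toLinearMap S.val.toLinearMap
      Subtype.val_injective Subtype.val_injective
  have hv : IsNilpotent (v ⊗ₜ[K] (1 : S) - (1 : S) ⊗ₜ[K] v) := by
    rw [← IsNilpotent.map_iff hinj]
    simpa [v] using hu
  have key : ∀ y z : AlgebraicClosure K, aeval y (minpoly K u) = 0 →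
      aeval z (minpoly K u) = 0 → y = z := by
    intro y z hy hz
    have := hv.map (Algebra.TensorProduct.productMap (Algebra.adjoin.liftSingleton K u y hy)
      (Algebra.adjoin.liftSingleton K u z hz))
    have h0 := this.eq_zero
    simp only [map_sub, Algebra.TensorProduct.productMap_apply_tmul, map_one, mul_one, one_mul,
      sub_eq_zero] at h0
    have hlift : ∀ (w : AlgebraicClosure K) (hw : aeval w (minpoly K u) = 0),
        Algebra.adjoin.liftSingleton K u w hw v = w := fun w hw => by
      have hroot : (AlgEquiv.adjoinSingletonEquivAdjoinRootMinpoly K u) v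
          = AdjoinRoot.root (minpoly K u) := by
        rw [← AlgEquiv.eq_symm_apply]
        exact Subtype.ext (by simp [AlgEquiv.adjoinSingletonEquivAdjoinRootMinpoly, v])
      change AdjoinRoot.liftAlgHom (minpoly K u) (Algebra.ofId K (AlgebraicClosure K)) w hw
        (AlgEquiv.adjoinSingletonEquivAdjoinRootMinpoly K u v) = w
      rw [hroot]
      exact AdjoinRoot.liftAlgHom_root (minpoly K u) (Algebra.ofId K (AlgebraicClosure K)) w hw
    rwa [hlift, hlift] at h0
  have hint : IsIntegral K u := by
    by_contra h
    have h0 := minpoly.eq_zero h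
    exact zero_ne_one (key 0 1 (by simp [h0]) (by simp [h0]))
  have hsep := (minpoly.irreducible hint).separable
  have hcard : (minpoly K u).natDegree ≤ 1 := by
    rw [← card_rootSet_eq_natDegree hsep (IsAlgClosed.splits
      (Polynomial.map (algebraMap K (AlgebraicClosure K)) (minpoly K u)))]
    rw [Fintype.card_le_one_iff]
    rintro ⟨y, hy⟩ ⟨z, hz⟩
    exact Subtype.ext (key y z (aeval_eq_zero_of_mem_rootSet hy) (aeval_eq_zero_of_mem_rootSet hz))
  have hdeg : (minpoly K u).degree = 1 := by
    rw [degree_eq_natDegree (minpoly.ne_zero hint)]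
    have := minpoly.natDegree_pos hint
    exact_mod_cast le_antisymm hcard this
  exact minpoly.mem_range_of_degree_eq_one K u hdeg

/-- In characteristic zero, a fraction of regular functions which is constant on the fibres of a
dominant morphism descends to the base. -/
theorem exists_mul_eq_mul_of_constant_on_fibres {E A B : Type*} [Field E] [IsAlgClosed E]
    [CharZero E] [CommRing A] [IsDomain A] [CommRing B] [IsDomain B] [Algebra E A] [Algebra E B]
    [Algebra A B] [IsScalarTower E A B] [Algebra.FiniteType E B]
    (hinj : Function.Injective (algebraMap A B)) {P Q : B} (hQ : Q ≠ 0)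
    (h : ∀ ψ₁ ψ₂ : B →ₐ[E] E, (∀ a : A, ψ₁ (algebraMap A B a) = ψ₂ (algebraMap A B a)) →
      ψ₁ P * ψ₂ Q = ψ₁ Q * ψ₂ P) :
    ∃ a b : A, a ≠ 0 ∧ algebraMap A B a * P = algebraMap A B b * Q := by
  have hft : Algebra.FiniteType E (B ⊗[A] B) := by
    have : Algebra.FiniteType A B := Algebra.FiniteType.of_restrictScalars_finiteType E A B
    exact Algebra.FiniteType.trans (S := B) inferInstance inferInstance
  have hnil : IsNilpotent (P ⊗ₜ[A] Q - Q ⊗ₜ[A] P) := by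
    refine isNilpotent_of_forall_algHom (E := E) fun ψ => ?_
    let ψ₁ : B →ₐ[E] E := ψ.comp (Algebra.TensorProduct.includeLeft (R := A) (S := E))
    let ψ₂ : B →ₐ[E] E := ψ.comp
      ((Algebra.TensorProduct.includeRight (R := A) (A := B) (B := B)).restrictScalars E)
    have hmul : ∀ x y : B, ψ (x ⊗ₜ[A] y) = ψ₁ x * ψ₂ y := fun x y => by
      simp [ψ₁, ψ₂, ← map_mul]
    rw [map_sub, hmul, hmul, sub_eq_zero]
    refine h ψ₁ ψ₂ fun a => ?_
    simp [ψ₁, ψ₂, Algebra.TensorProduct.tmul_one_eq_one_tmul]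
  let K := FractionRing A
  let L := FractionRing B
  have hAL : Function.Injective (algebraMap A L) := by
    rw [IsScalarTower.algebraMap_eq A B L]
    exact (IsFractionRing.injective B L).comp hinj
  have : FaithfulSMul A L := (faithfulSMul_iff_algebraMap_injective A L).mpr hAL
  let : Algebra K L := FractionRing.liftAlgebra A L
  have : IsScalarTower A K L := inferInstance
  have : CharZero K := charZero_of_injective_algebraMap (R := E) (algebraMap E K).injective
  let j₁ : B →ₐ[A] L ⊗[K] L := ((Algebra.TensorProduct.includeLeft (R := K) (S := K)
    (A := L) (B := L)).restrictScalars A).comp (IsScalarTower.toAlgHom A B L)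
  let j₂ : B →ₐ[A] L ⊗[K] L := ((Algebra.TensorProduct.includeRight (R := K)
    (A := L) (B := L)).restrictScalars A).comp (IsScalarTower.toAlgHom A B L)
  have hnil' := hnil.map (Algebra.TensorProduct.productMap j₁ j₂)
  let p : L := algebraMap B L P
  let q : L := algebraMap B L Q
  have hq : q ≠ 0 := (map_ne_zero_iff _ (IsFractionRing.injective B L)).mpr hQ
  have heq : Algebra.TensorProduct.productMap j₁ j₂ (P ⊗ₜ[A] Q - Q ⊗ₜ[A] P)
      = p ⊗ₜ[K] q - q ⊗ₜ[K] p := by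
    simp [j₁, j₂, p, q]
  rw [heq] at hnil'
  have hu : IsNilpotent ((p / q) ⊗ₜ[K] (1 : L) - (1 : L) ⊗ₜ[K] (p / q)) := by
    have : (p / q) ⊗ₜ[K] (1 : L) - (1 : L) ⊗ₜ[K] (p / q)
        = (q⁻¹ ⊗ₜ[K] q⁻¹) * (p ⊗ₜ[K] q - q ⊗ₜ[K] p) := by
      rw [mul_sub, Algebra.TensorProduct.tmul_mul_tmul, Algebra.TensorProduct.tmul_mul_tmul,
        inv_mul_cancel₀ hq, div_eq_inv_mul]
    rw [this]
    exact (Commute.all _ _).isNilpotent_mul_left hnil'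
  obtain ⟨r, hr⟩ := mem_range_algebraMap_of_isNilpotent_tmul_sub hu
  obtain ⟨b, a, ha, rfl⟩ := IsFractionRing.div_surjective (A := A) r
  have ha0 : a ≠ 0 := nonZeroDivisors.ne_zero ha
  refine ⟨a, b, ha0, IsFractionRing.injective B L ?_⟩
  have haL : algebraMap A L a ≠ 0 := (map_ne_zero_iff _ hAL).mpr ha0
  rw [map_div₀, ← IsScalarTower.algebraMap_apply, ← IsScalarTower.algebraMap_apply,
    div_eq_div_iff haL hq] at hr
  rw [map_mul, map_mul, ← IsScalarTower.algebraMap_apply, ← IsScalarTower.algebraMap_apply]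
  exact (mul_comm _ _).trans hr.symm

/-- The image of a dominant morphism contains a nonempty basic open set. -/
theorem exists_ne_zero_forall_algHom_extends {E : Type*} {A B : Type _} [Field E] [IsAlgClosed E]
    [CommRing A] [IsDomain A] [IsNoetherianRing A] [CommRing B] [IsDomain B] [Algebra E A]
    [Algebra E B] [Algebra A B] [IsScalarTower E A B] [Algebra.FiniteType E B]
    (hinj : Function.Injective (algebraMap A B)) :
    ∃ a : A, a ≠ 0 ∧ ∀ ψ : A →ₐ[E] E, ψ a ≠ 0 →
      ∃ ψ' : B →ₐ[E] E, ∀ x, ψ' (algebraMap A B x) = ψ x := by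
  have : Algebra.FiniteType A B := Algebra.FiniteType.of_restrictScalars_finiteType E A B
  have hfp : (algebraMap A B).FinitePresentation :=
    RingHom.finitePresentation_algebraMap.mpr
      (Algebra.FinitePresentation.of_finiteType.mp inferInstance)
  obtain ⟨S, hS⟩ := PrimeSpectrum.exists_constructibleSetData_iff.mpr
    (PrimeSpectrum.isConstructible_range_comap hfp)
  have hbot : (⊥ : PrimeSpectrum A) ∈ S.toSet := by
    rw [hS]
    refine ⟨⊥, PrimeSpectrum.ext ?_⟩
    exact (RingHom.injective_iff_ker_eq_bot _).mp hinj
  simp only [PrimeSpectrum.ConstructibleSetData.toSet, Set.mem_iUnion] at hbot hS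
  obtain ⟨C, hC, hCb⟩ := hbot
  have hg : ∀ i, C.g i = 0 := fun i => by
    have := hCb.1 ⟨i, rfl⟩
    simpa using this
  have hf : C.f ≠ 0 := fun h0 => hCb.2 (by simp [h0])
  refine ⟨C.f, hf, fun ψ hψ => ?_⟩
  let x : PrimeSpectrum A := ⟨RingHom.ker ψ, RingHom.ker_isPrime _⟩
  have hx : x ∈ C.toSet := by
    refine ⟨?_, ?_⟩
    · rintro _ ⟨i, rfl⟩
      simp [hg i]
    · intro hmem
      exact hψ (by simpa [x] using hmem)
  have hxr : x ∈ Set.range (PrimeSpectrum.comap (algebraMap A B)) := by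
    rw [← hS]
    exact Set.mem_iUnion₂.mpr ⟨C, hC, hx⟩
  obtain ⟨y, hy⟩ := hxr
  obtain ⟨ψ', hψ'⟩ := exists_algHom_le_ker (E := E) y.2.ne_top
  refine ⟨ψ', fun a => ?_⟩
  have hmem : a - algebraMap E A (ψ a) ∈ x.asIdeal := by simp [x, RingHom.mem_ker]
  rw [← hy] at hmem
  have := hψ' hmem
  rw [RingHom.mem_ker, map_sub, map_sub, ← IsScalarTower.algebraMap_apply, AlgHom.commutes,
    sub_eq_zero] at this
  simpa using this

/-- Greatest common divisors of arbitrary families in a noetherian factorial ring. -/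
theorem exists_gcd_of_family {R ι : Type*} [CommRing R] [IsDomain R] [IsNoetherianRing R]
    [UniqueFactorizationMonoid R] (p : ι → R) :
    ∃ D : R, (∀ i, D ∣ p i) ∧ ∀ c d : R, (∀ i, d ∣ c * p i) → d ∣ c * D := by
  classical
  let : StrongNormalizationMonoid R := UniqueFactorizationMonoid.strongNormalizationMonoid
  let : StrongNormalizedGCDMonoid R := UniqueFactorizationMonoid.toStrongNormalizedGCDMonoid R
  obtain ⟨s, hs, hspan⟩ := (Submodule.fg_span_iff_fg_span_finset_subset (Set.range p)).mp
    (IsNoetherian.noetherian (Submodule.span R (Set.range p)))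
  refine ⟨s.gcd id, fun i => ?_, fun c d h => ?_⟩
  · have hle : Submodule.span R (s : Set R) ≤ Ideal.span {s.gcd id} :=
      Submodule.span_le.mpr fun x hx => Ideal.mem_span_singleton.mpr (Finset.gcd_dvd hx)
    exact Ideal.mem_span_singleton.mp (hle (hspan ▸ Submodule.subset_span ⟨i, rfl⟩))
  · have h1 : d ∣ s.gcd fun x => c * id x := Finset.dvd_gcd fun x hx => by
      obtain ⟨i, rfl⟩ := hs hx
      exact h i
    rw [Finset.gcd_mul_left] at h1
    exact h1.trans ((associated_normalize c).symm.mul_right _).dvd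

end CommutativeAlgebra

section Topology

/-- A connected noetherian space with a transitive group of homeomorphisms is irreducible. -/
theorem irreducibleSpace_of_homogeneous {X : Type*} [TopologicalSpace X]
    [TopologicalSpace.NoetherianSpace X] [ConnectedSpace X]
    (hX : ∀ x y : X, ∃ h : X ≃ₜ X, h x = y) : IrreducibleSpace X := by
  obtain ⟨x₀⟩ := (inferInstance : Nonempty X)
  have hZ := irreducibleComponent_mem_irreducibleComponents x₀
  set Z := irreducibleComponent x₀
  obtain ⟨U, hUo, hUne, hUZ⟩ :=
    TopologicalSpace.NoetherianSpace.exists_isOpen_nonempty_subset_irreducibleComponent Z hZ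
  have hloc : ∀ x : X, ∃ W : Set X, IsOpen W ∧ x ∈ W ∧ IsPreirreducible W := by
    intro x
    obtain ⟨u, hu⟩ := hUne
    obtain ⟨h, rfl⟩ := hX u x
    refine ⟨h '' U, h.isOpenMap U hUo, ⟨u, hu, rfl⟩, ?_⟩
    exact (hZ.1.isPreirreducible.open_subset hUo hUZ).image h h.continuous.continuousOn
  have hZc : IsClosed Z := isClosed_irreducibleComponent
  have hZo : IsOpen Z := by
    rw [isOpen_iff_forall_mem_open]
    intro x hx
    obtain ⟨W, hWo, hxW, hW⟩ := hloc x
    have hsub : Z ⊆ closure W :=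
      (subset_closure_inter_of_isPreirreducible_of_isOpen hZ.1.isPreirreducible hWo
        ⟨x, hx, hxW⟩).trans (closure_mono Set.inter_subset_right)
    have hirr : IsIrreducible (closure W) := ⟨⟨x, subset_closure hxW⟩, hW.closure⟩
    exact ⟨W, subset_closure.trans (hZ.2 hirr hsub), hWo, hxW⟩
  have huniv : Z = Set.univ := IsClopen.eq_univ ⟨hZc, hZo⟩ ⟨x₀, mem_irreducibleComponent⟩
  have h1 : IsIrreducible (Set.univ : Set X) := huniv ▸ hZ.1
  exact irreducibleSpace_def X |>.mpr h1

end Topology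

namespace Prehomogeneous

section Zariski

variable {E σ : Type*} [Field E]

theorem mem_closure_zariski_iff {S : Set (σ → E)} {x : σ → E} :
    x ∈ @closure _ (zariski E σ) S ↔
      ∀ p : MvPolynomial σ E, (∀ y ∈ S, MvPolynomial.eval y p = 0) → MvPolynomial.eval x p = 0 := by
  rw [closure_induced, ← PrimeSpectrum.zeroLocus_vanishingIdeal_eq_closure,
    MvPolynomial.vanishingIdeal_pointToPoint, PrimeSpectrum.mem_zeroLocus]
  simp only [Set.subset_def, SetLike.mem_coe, MvPolynomial.mem_vanishingIdeal_iff,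
    MvPolynomial.pointToPoint, Set.mem_singleton_iff, forall_eq, MvPolynomial.aeval_eq_eval]

theorem dense_zariski_iff {S : Set (σ → E)} :
    @Dense _ (zariski E σ) S ↔ ∀ p : MvPolynomial σ E, (∀ y ∈ S, MvPolynomial.eval y p = 0) →
      ∀ x, MvPolynomial.eval x p = 0 := by
  simp only [Dense, mem_closure_zariski_iff]
  exact ⟨fun h p hp x => h x p hp, fun h x p hp => h p hp x⟩

end Zariski

section CoordinateRing

variable {E : Type*} [Field E] {m : ℕ} (G : Subgroup (GL (Fin m) E))

/-- The algebra of regular functions on a subgroup of `GL_m`. -/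
noncomputable def coordRing : Subalgebra E (G → E) :=
  (MvPolynomial.aeval (R := E)
    (fun (o : Option (Fin m × Fin m)) (g : G) => glCoord g.1 o)).range

variable {G}

theorem mem_coordRing_iff {f : G → E} : f ∈ coordRing G ↔ IsRegular f := by
  have key : ∀ (P : MvPolynomial (Option (Fin m × Fin m)) E) (g : G),
      MvPolynomial.aeval (R := E) (fun (o : Option (Fin m × Fin m)) (g : G) => glCoord g.1 o) P g
        = MvPolynomial.eval (glCoord g.1) P := fun P g => by
    have := MvPolynomial.comp_aeval_apply
      (fun (o : Option (Fin m × Fin m)) (g : G) => glCoord g.1 o) (Pi.evalAlgHom E (fun _ => E) g) P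
    simpa [MvPolynomial.coe_aeval_eq_eval] using this
  constructor
  · rintro ⟨P, rfl⟩
    exact ⟨P, key P⟩
  · rintro ⟨P, hP⟩
    exact ⟨P, funext fun g => (key P g).trans (hP g).symm⟩

theorem glCoord_mem_coordRing (o : Option (Fin m × Fin m)) :
    (fun g : G => glCoord g.1 o) ∈ coordRing G :=
  mem_coordRing_iff.mpr ⟨MvPolynomial.X o, fun g => by simp⟩

instance : Algebra.FiniteType E (coordRing G) :=
  Algebra.FiniteType.of_surjective (AlgHom.rangeRestrict _) (AlgHom.rangeRestrict_surjective _)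

theorem eval_eq_of_algHom (ψ : coordRing G →ₐ[E] E) (P : MvPolynomial (Option (Fin m × Fin m)) E)
    (hP : (fun g : G => MvPolynomial.eval (glCoord g.1) P) ∈ coordRing G) :
    ψ ⟨_, hP⟩ = MvPolynomial.eval (fun o => ψ ⟨_, glCoord_mem_coordRing o⟩) P := by
  have h1 := MvPolynomial.comp_aeval_apply (R := E)
    (fun o => (⟨_, glCoord_mem_coordRing o⟩ : coordRing G)) ψ P
  rw [MvPolynomial.aeval_eq_eval] at h1
  rw [← h1]
  congr 1
  refine Subtype.ext (funext fun g => ?_)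
  have h2 := MvPolynomial.comp_aeval_apply (R := E)
    (fun o => (⟨_, glCoord_mem_coordRing o⟩ : coordRing G))
    ((Pi.evalAlgHom E (fun _ => E) g).comp (coordRing G).val) P
  rw [MvPolynomial.aeval_eq_eval] at h2
  exact h2.symm

theorem mem_closure_glZariski_iff {S : Set (GL (Fin m) E)} {x : GL (Fin m) E} :
    x ∈ @closure _ (glZariski E m) S ↔ ∀ P : MvPolynomial (Option (Fin m × Fin m)) E,
      (∀ g ∈ S, MvPolynomial.eval (glCoord g) P = 0) → MvPolynomial.eval (glCoord x) P = 0 := by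
  let := zariski E (Option (Fin m × Fin m))
  rw [closure_induced, mem_closure_zariski_iff]
  simp only [Set.forall_mem_image]

/-- The points of a closed subgroup are the rational points of its coordinate ring. -/
theorem exists_eq_of_algHom (hG : @IsClosed _ (glZariski E m) (G : Set (GL (Fin m) E)))
    (ψ : coordRing G →ₐ[E] E) : ∃ g : G, ∀ f : coordRing G, ψ f = f.1 g := by
  let x : Option (Fin m × Fin m) → E := fun o => ψ ⟨_, glCoord_mem_coordRing o⟩
  let A : Matrix (Fin m) (Fin m) E := Matrix.of fun i j => x (some (i, j))
  let XX : Matrix (Fin m) (Fin m) (MvPolynomial (Option (Fin m × Fin m)) E) :=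
    Matrix.of fun i j => MvPolynomial.X (some (i, j))
  have hXX : ∀ y : Option (Fin m × Fin m) → E, MvPolynomial.eval y XX.det
      = (Matrix.of fun i j => y (some (i, j))).det := fun y => by
    rw [RingHom.map_det]
    congr 1
    ext i j
    simp [XX]
  have hvan : ∀ P : MvPolynomial (Option (Fin m × Fin m)) E,
      (∀ g ∈ G, MvPolynomial.eval (glCoord g) P = 0) → MvPolynomial.eval x P = 0 := fun P hP => by
    have h0 : (fun g : G => MvPolynomial.eval (glCoord g.1) P) = 0 := funext fun g => hP g.1 g.2
    have hmem : (fun g : G => MvPolynomial.eval (glCoord g.1) P) ∈ coordRing G :=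
      mem_coordRing_iff.mpr ⟨P, fun _ => rfl⟩
    rw [← eval_eq_of_algHom ψ P hmem]
    have : (⟨_, hmem⟩ : coordRing G) = 0 := Subtype.ext h0
    rw [this, map_zero]
  have hdet : x none * A.det = 1 := by
    have := hvan (MvPolynomial.X none * XX.det - 1) fun g _ => by
      have hg : (g : Matrix (Fin m) (Fin m) E).det ≠ 0 :=
        (Matrix.isUnit_iff_isUnit_det _ |>.mp g.isUnit).ne_zero
      rw [map_sub, map_mul, hXX, MvPolynomial.eval_X, map_one, sub_eq_zero]
      exact inv_mul_cancel₀ hg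
    rw [map_sub, map_mul, hXX, MvPolynomial.eval_X, map_one, sub_eq_zero] at this
    exact this
  have hA : A.det ≠ 0 := right_ne_zero_of_mul_eq_one hdet
  let g : GL (Fin m) E := Matrix.GeneralLinearGroup.mkOfDetNeZero A hA
  have hgx : glCoord g = x := by
    funext o
    match o with
    | none => exact (eq_inv_of_mul_eq_one_left hdet).symm
    | some p => rfl
  have hgG : g ∈ G := by
    have : g ∈ @closure _ (glZariski E m) (G : Set (GL (Fin m) E)) :=
      mem_closure_glZariski_iff.mpr fun P hP => hgx ▸ hvan P hP
    rwa [@IsClosed.closure_eq _ (glZariski E m) _ hG] at this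
  refine ⟨⟨g, hgG⟩, fun f => ?_⟩
  obtain ⟨P, hP⟩ := mem_coordRing_iff.mp f.2
  have hf : f.1 = fun g : G => MvPolynomial.eval (glCoord g.1) P := funext hP
  have hmem : (fun g : G => MvPolynomial.eval (glCoord g.1) P) ∈ coordRing G := hf ▸ f.2
  have : f = ⟨_, hmem⟩ := Subtype.ext hf
  rw [this, eval_eq_of_algHom ψ P hmem]
  exact congrArg (fun y => MvPolynomial.eval y P) hgx.symm

end CoordinateRing

section GroupGeometry

open scoped TensorProduct

variable {E : Type*} [Field E] {m : ℕ} {G : Subgroup (GL (Fin m) E)}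

/-- Precomposition, as a homomorphism of algebras of functions. -/
def precomp (E : Type*) [Field E] {X Y : Type*} (θ : X → Y) : (Y → E) →ₐ[E] (X → E) :=
  AlgHom.pi fun x => Pi.evalAlgHom E _ (θ x)

@[simp]
theorem precomp_apply {X Y : Type*} (θ : X → Y) (f : Y → E) (x : X) :
    precomp E θ f x = f (θ x) := rfl

/-- Comultiplication of regular functions. -/
theorem exists_comul {f : G → E} (hf : f ∈ coordRing G) :
    ∃ S : Finset (coordRing G × coordRing G),
      ∀ g h : G, f (g * h) = ∑ i ∈ S, i.1.1 g * i.2.1 h := by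
  let pm : coordRing G ⊗[E] coordRing G →ₐ[E] (G × G → E) := Algebra.TensorProduct.productMap
    ((precomp E Prod.fst).comp (coordRing G).val) ((precomp E Prod.snd).comp (coordRing G).val)
  have hpm : ∀ (a b : coordRing G) (x : G × G), pm (a ⊗ₜ b) x = a.1 x.1 * b.1 x.2 := fun a b x => by
    simp only [pm, Algebra.TensorProduct.productMap_apply_tmul]
    rfl
  have hle : coordRing G ≤ pm.range.comap (precomp E fun x : G × G => x.1 * x.2) := by
    have hadj : coordRing G = Algebra.adjoin E
        (Set.range fun (o : Option (Fin m × Fin m)) (g : G) => glCoord g.1 o) :=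
      (Algebra.adjoin_range_eq_range_aeval E _).symm
    refine hadj.trans_le (Algebra.adjoin_le_iff.mpr ?_)
    rintro _ ⟨o, rfl⟩
    match o with
    | none =>
      refine ⟨⟨_, glCoord_mem_coordRing none⟩ ⊗ₜ ⟨_, glCoord_mem_coordRing none⟩,
        funext fun x => ?_⟩
      change pm _ x = _
      rw [hpm]
      simp [glCoord, mul_comm]
    | some p =>
      refine ⟨∑ k, ⟨_, glCoord_mem_coordRing (some (p.1, k))⟩ ⊗ₜ
        ⟨_, glCoord_mem_coordRing (some (k, p.2))⟩, funext fun x => ?_⟩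
      change pm _ x = _
      rw [map_sum, Finset.sum_apply]
      simp only [hpm]
      simp [glCoord, Matrix.mul_apply]
  obtain ⟨t, ht⟩ := hle hf
  obtain ⟨S, rfl⟩ := TensorProduct.exists_finset t
  refine ⟨S, fun g h => ?_⟩
  have := congrFun ht (g, h)
  change pm _ (g, h) = f (g * h) at this
  rw [← this, map_sum, Finset.sum_apply]
  simp only [hpm]

theorem mul_left_mem_coordRing {f : G → E} (hf : f ∈ coordRing G) (a : G) :
    (fun g => f (a * g)) ∈ coordRing G := by
  obtain ⟨S, hS⟩ := exists_comul hf
  have : (fun g => f (a * g)) = ∑ i ∈ S, i.1.1 a • i.2.1 := by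
    funext g
    simp [hS]
  rw [this]
  exact Subalgebra.sum_mem _ fun i _ => Subalgebra.smul_mem _ i.2.2 _

theorem mul_right_mem_coordRing {f : G → E} (hf : f ∈ coordRing G) (a : G) :
    (fun g => f (g * a)) ∈ coordRing G := by
  obtain ⟨S, hS⟩ := exists_comul hf
  have : (fun g => f (g * a)) = ∑ i ∈ S, i.2.1 a • i.1.1 := by
    funext g
    simp [hS, mul_comm]
  rw [this]
  exact Subalgebra.sum_mem _ fun i _ => Subalgebra.smul_mem _ i.1.2 _

/-- The left translates of a regular function lie in a finite-dimensional space. -/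
theorem finiteDimensional_span_mul_left {f : G → E} (hf : f ∈ coordRing G) :
    FiniteDimensional E (Submodule.span E (Set.range fun a : G => fun g : G => f (a * g))) := by
  obtain ⟨S, hS⟩ := exists_comul hf
  let W := Submodule.span E ((fun i : coordRing G × coordRing G => i.2.1) '' (S : Set _))
  have hfin : FiniteDimensional E W := FiniteDimensional.span_of_finite E (S.finite_toSet.image _)
  refine Submodule.finiteDimensional_of_le (S₂ := W) (Submodule.span_le.mpr ?_)
  rintro _ ⟨a, rfl⟩
  have : (fun g => f (a * g)) = ∑ i ∈ S, i.1.1 a • i.2.1 := by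
    funext g
    simp [hS]
  change (fun g => f (a * g)) ∈ W
  rw [this]
  exact Submodule.sum_mem _ fun i hi => Submodule.smul_mem _ _
    (Submodule.subset_span ⟨i, hi, rfl⟩)

/-- The right translates of a regular function lie in a finite-dimensional space. -/
theorem finiteDimensional_span_mul_right {f : G → E} (hf : f ∈ coordRing G) :
    FiniteDimensional E (Submodule.span E (Set.range fun a : G => fun g : G => f (g * a))) := by
  obtain ⟨S, hS⟩ := exists_comul hf
  let W := Submodule.span E ((fun i : coordRing G × coordRing G => i.1.1) '' (S : Set _))
  have hfin : FiniteDimensional E W := FiniteDimensional.span_of_finite E (S.finite_toSet.image _)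
  refine Submodule.finiteDimensional_of_le (S₂ := W) (Submodule.span_le.mpr ?_)
  rintro _ ⟨a, rfl⟩
  have : (fun g => f (g * a)) = ∑ i ∈ S, i.2.1 a • i.1.1 := by
    funext g
    simp [hS, mul_comm]
  change (fun g => f (g * a)) ∈ W
  rw [this]
  exact Submodule.sum_mem _ fun i hi => Submodule.smul_mem _ _
    (Submodule.subset_span ⟨i, hi, rfl⟩)

variable (G) in
/-- The Zariski topology on a subgroup of `GL_m`. -/
@[reducible]
noncomputable def groupZariski : TopologicalSpace G :=
  TopologicalSpace.induced Subtype.val (glZariski E m)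

theorem mem_closure_groupZariski_iff {S : Set G} {x : G} :
    x ∈ @closure _ (groupZariski G) S ↔
      ∀ f ∈ coordRing G, (∀ g ∈ S, f g = 0) → f x = 0 := by
  let := glZariski E m
  rw [closure_induced, mem_closure_glZariski_iff]
  simp only [Set.forall_mem_image]
  constructor
  · intro h f hf hS
    obtain ⟨P, hP⟩ := mem_coordRing_iff.mp hf
    rw [hP]
    exact h P fun g hg => hP g ▸ hS g hg
  · intro h P hS
    exact h (fun g => MvPolynomial.eval (glCoord g.1) P)
      (mem_coordRing_iff.mpr ⟨P, fun _ => rfl⟩) hS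

theorem continuous_mul_left_groupZariski (a : G) :
    @Continuous _ _ (groupZariski G) (groupZariski G) (fun g => a * g) := by
  let := groupZariski G
  rw [continuous_iff_image_closure_subset_closure_image]
  rintro S _ ⟨x, hx, rfl⟩
  rw [mem_closure_groupZariski_iff] at hx ⊢
  intro f hf hS
  exact hx _ (mul_left_mem_coordRing hf a) fun g hg => hS _ ⟨g, hg, rfl⟩

theorem irreducibleSpace_groupZariski (hG : IsConnectedLinearAlgebraicGroup G) :
    @IrreducibleSpace G (groupZariski G) := by
  let := groupZariski G
  have : TopologicalSpace.NoetherianSpace G := by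
    let := glZariski E m
    let := zariski E (Option (Fin m × Fin m))
    have h1 : Topology.IsInducing (Subtype.val : G → GL (Fin m) E) := ⟨rfl⟩
    have h2 : Topology.IsInducing (glCoord : GL (Fin m) E → _) := ⟨rfl⟩
    have h3 : Topology.IsInducing (MvPolynomial.pointToPoint :
      (Option (Fin m × Fin m) → E) → PrimeSpectrum (MvPolynomial _ E)) := ⟨rfl⟩
    exact (h3.comp (h2.comp h1)).noetherianSpace
  have : ConnectedSpace G := by
    let := glZariski E m
    exact isConnected_iff_connectedSpace.mp hG.isConnected
  refine irreducibleSpace_of_homogeneous fun x y => ⟨⟨Equiv.mulLeft (y * x⁻¹), ?_, ?_⟩, ?_⟩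
  · exact continuous_mul_left_groupZariski _
  · exact continuous_mul_left_groupZariski _
  · simp

/-- The coordinate ring of a connected group is a domain. -/
theorem isDomain_coordRing (hG : IsConnectedLinearAlgebraicGroup G) : IsDomain (coordRing G) := by
  let := groupZariski G
  have := irreducibleSpace_groupZariski hG
  have hclosed : ∀ f : coordRing G, IsClosed {g | f.1 g = 0} := fun f =>
    isClosed_of_closure_subset fun x hx =>
      mem_closure_groupZariski_iff.mp hx f.1 f.2 fun g hg => hg
  have : NoZeroDivisors (coordRing G) := ⟨fun {a b} hab => by
    have hcov : (Set.univ : Set G) ⊆ {g | a.1 g = 0} ∪ {g | b.1 g = 0} := fun g _ => by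
      have := congrFun (congrArg Subtype.val hab) g
      exact mul_eq_zero.mp this
    rcases isPreirreducible_iff_isClosed_union_isClosed.mp
      (PreirreducibleSpace.isPreirreducible_univ (X := G)) _ _ (hclosed a) (hclosed b) hcov
      with h | h
    · exact Or.inl (Subtype.ext (funext fun g => h (Set.mem_univ g)))
    · exact Or.inr (Subtype.ext (funext fun g => h (Set.mem_univ g)))⟩
  exact NoZeroDivisors.to_isDomain _

/-- A function on a closed subgroup which is locally a fraction of regular functions is regular. -/
theorem mem_coordRing_of_locally [IsAlgClosed E]
    (hG : @IsClosed _ (glZariski E m) (G : Set (GL (Fin m) E))) {c : G → E}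
    (hc : ∀ b : G, ∃ w ∈ coordRing G, w b ≠ 0 ∧ w * c ∈ coordRing G) : c ∈ coordRing G := by
  let I : Ideal (coordRing G) :=
    { carrier := {w | w.1 * c ∈ coordRing G}
      zero_mem' := by
        change (0 : G → E) * c ∈ coordRing G
        rw [zero_mul]
        exact zero_mem _
      add_mem' := fun {a b} ha hb => by
        change (a.1 + b.1) * c ∈ coordRing G
        rw [add_mul]
        exact add_mem ha hb
      smul_mem' := fun a b hb => by
        change (a.1 * b.1) * c ∈ coordRing G
        rw [mul_assoc]
        exact mul_mem a.2 hb }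
  have hI : I = ⊤ := by
    by_contra hne
    obtain ⟨ψ, hψ⟩ := exists_algHom_le_ker (E := E) hne
    obtain ⟨b, hb⟩ := exists_eq_of_algHom hG ψ
    obtain ⟨w, hw, hwb, hwc⟩ := hc b
    have : ψ ⟨w, hw⟩ = 0 := hψ (show (⟨w, hw⟩ : coordRing G) ∈ I from hwc)
    exact hwb ((hb _).symm.trans this)
  have h1 : (1 : coordRing G) ∈ I := hI ▸ Submodule.mem_top
  have h2 : (1 : G → E) * c ∈ coordRing G := h1
  rwa [one_mul] at h2

end GroupGeometry

section Action

variable {E : Type*} [Field E] {m n : ℕ} {G : Subgroup (GL (Fin m) E)}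
  [MulAction G (Fin n → E)]

theorem eval_smul_mem_coordRing (hreg : IsRegularAction (n := n) G) (ξ : Fin n → E)
    (p : MvPolynomial (Fin n) E) : (fun g : G => MvPolynomial.eval (g • ξ) p) ∈ coordRing G := by
  obtain ⟨F, hF⟩ := hreg
  refine mem_coordRing_iff.mpr ⟨MvPolynomial.bind₁ (fun i => MvPolynomial.aeval (Sum.elim
    MvPolynomial.X (fun j => MvPolynomial.C (ξ j))) (F i)) p, fun g => ?_⟩
  change MvPolynomial.eval (g • ξ) p = _
  rw [← MvPolynomial.aeval_eq_eval, ← MvPolynomial.aeval_eq_eval, MvPolynomial.aeval_bind₁]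
  congr 2
  funext i
  rw [hF, MvPolynomial.comp_aeval_apply, MvPolynomial.aeval_eq_eval]
  congr 2
  funext o
  cases o <;> simp

/-- The comorphism of the orbit map `g ↦ g • ξ`. -/
noncomputable def orbitHom (hreg : IsRegularAction (n := n) G) (ξ : Fin n → E) :
    MvPolynomial (Fin n) E →ₐ[E] coordRing G where
  toFun p := ⟨fun g => MvPolynomial.eval (g • ξ) p, eval_smul_mem_coordRing hreg ξ p⟩
  map_one' := Subtype.ext (funext fun g => by simp)
  map_mul' p q := Subtype.ext (funext fun g => by simp)
  map_zero' := Subtype.ext (funext fun g => by simp)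
  map_add' p q := Subtype.ext (funext fun g => by simp)
  commutes' c := Subtype.ext (funext fun g => by simp)

@[simp]
theorem orbitHom_apply (hreg : IsRegularAction (n := n) G) (ξ : Fin n → E)
    (p : MvPolynomial (Fin n) E) (g : G) :
    (orbitHom hreg ξ p).1 g = MvPolynomial.eval (g • ξ) p := rfl

theorem orbitHom_injective [Infinite E] (hreg : IsRegularAction (n := n) G) {ξ : Fin n → E}
    (hξ : ξ ∈ genericPoints (n := n) G) : Function.Injective (orbitHom hreg ξ) := by
  rw [injective_iff_map_eq_zero]
  intro p hp
  refine MvPolynomial.funext fun x => ?_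
  rw [map_zero]
  refine dense_zariski_iff.mp hξ p ?_ x
  rintro _ ⟨g, rfl⟩
  exact congrFun (congrArg Subtype.val hp) g

theorem exists_translate (hreg : IsRegularAction (n := n) G) (g : G) :
    ∃ τ : MvPolynomial (Fin n) E →ₐ[E] MvPolynomial (Fin n) E,
      ∀ x p, MvPolynomial.eval x (τ p) = MvPolynomial.eval (g • x) p := by
  obtain ⟨F, hF⟩ := hreg
  refine ⟨MvPolynomial.bind₁ (fun i => MvPolynomial.aeval (Sum.elim
    (fun o => MvPolynomial.C (glCoord g.1 o)) MvPolynomial.X) (F i)), fun x p => ?_⟩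
  rw [← MvPolynomial.aeval_eq_eval, ← MvPolynomial.aeval_eq_eval, MvPolynomial.aeval_bind₁]
  congr 2
  funext i
  rw [hF, MvPolynomial.comp_aeval_apply, MvPolynomial.aeval_eq_eval]
  congr 2
  funext o
  cases o <;> simp

/-- The translate `p ∘ g` of a polynomial function `p`. -/
noncomputable def translate (hreg : IsRegularAction (n := n) G) (g : G) :
    MvPolynomial (Fin n) E →ₐ[E] MvPolynomial (Fin n) E :=
  (exists_translate hreg g).choose

@[simp]
theorem eval_translate (hreg : IsRegularAction (n := n) G) (g : G) (x : Fin n → E)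
    (p : MvPolynomial (Fin n) E) :
    MvPolynomial.eval x (translate hreg g p) = MvPolynomial.eval (g • x) p :=
  (exists_translate hreg g).choose_spec x p

variable [Infinite E]

@[simp]
theorem translate_inv_translate (hreg : IsRegularAction (n := n) G) (g : G)
    (p : MvPolynomial (Fin n) E) : translate hreg g⁻¹ (translate hreg g p) = p :=
  MvPolynomial.funext fun x => by simp

@[simp]
theorem translate_translate_inv (hreg : IsRegularAction (n := n) G) (g : G)
    (p : MvPolynomial (Fin n) E) : translate hreg g (translate hreg g⁻¹ p) = p :=
  MvPolynomial.funext fun x => by simp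

theorem translate_injective (hreg : IsRegularAction (n := n) G) (g : G) :
    Function.Injective (translate hreg g) :=
  Function.LeftInverse.injective (translate_inv_translate hreg g)

end Action

section Extension

variable {E : Type*} [Field E] {m n : ℕ} {G : Subgroup (GL (Fin m) E)}
  [MulAction G (Fin n → E)]

/-- A fraction of regular functions on the group which is invariant under the stabiliser of a
generic point is a rational function on the affine space. -/
theorem exists_descent [IsAlgClosed E] [CharZero E] (hG : IsConnectedLinearAlgebraicGroup G)
    (hreg : IsRegularAction (n := n) G) {ξ : Fin n → E} (hξ : ξ ∈ genericPoints (n := n) G)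
    {P Q : coordRing G} (hQ : Q ≠ 0)
    (h : ∀ g h : G, h • ξ = ξ → P.1 g * Q.1 (g * h) = Q.1 g * P.1 (g * h)) :
    ∃ a b : MvPolynomial (Fin n) E, a ≠ 0 ∧ orbitHom hreg ξ a * P = orbitHom hreg ξ b * Q := by
  have := isDomain_coordRing hG
  let : Algebra (MvPolynomial (Fin n) E) (coordRing G) := (orbitHom hreg ξ).toRingHom.toAlgebra
  have : IsScalarTower E (MvPolynomial (Fin n) E) (coordRing G) :=
    IsScalarTower.of_algebraMap_eq fun c => ((orbitHom hreg ξ).commutes c).symm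
  refine exists_mul_eq_mul_of_constant_on_fibres (E := E) (A := MvPolynomial (Fin n) E)
    (orbitHom_injective hreg hξ) hQ fun ψ₁ ψ₂ hψ => ?_
  obtain ⟨g₁, hg₁⟩ := exists_eq_of_algHom hG.isClosed ψ₁
  obtain ⟨g₂, hg₂⟩ := exists_eq_of_algHom hG.isClosed ψ₂
  have hfib : g₁ • ξ = g₂ • ξ := by
    funext i
    have := hψ (MvPolynomial.X i)
    rw [hg₁, hg₂] at this
    change MvPolynomial.eval (g₁ • ξ) (MvPolynomial.X i)
      = MvPolynomial.eval (g₂ • ξ) (MvPolynomial.X i) at this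
    simpa using this
  have := h g₁ (g₁⁻¹ * g₂) (by rw [mul_smul, ← hfib, inv_smul_smul])
  simpa [hg₁, hg₂] using this

theorem coordRing_ne_zero_iff {f : coordRing G} : f ≠ 0 ↔ ∃ g, f.1 g ≠ 0 := by
  rw [Ne, ← Subalgebra.coe_eq_zero, funext_iff]
  push Not
  rfl

/-- Left translation of regular functions. -/
noncomputable def leftTranslate (a : G) (f : coordRing G) : coordRing G :=
  ⟨fun g => f.1 (a * g), mul_left_mem_coordRing f.2 a⟩

theorem leftTranslate_ne_zero {f : coordRing G} (hf : f ≠ 0) (a : G) : leftTranslate a f ≠ 0 := by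
  obtain ⟨g, hg⟩ := coordRing_ne_zero_iff.mp hf
  exact coordRing_ne_zero_iff.mpr ⟨a⁻¹ * g, by simpa [leftTranslate] using hg⟩

/-- A rational function on the group which is multiplied by nonzero constants under left
translations is, up to a constant, a character. -/
theorem exists_character_of_left_semiinvariant [IsAlgClosed E]
    (hG : IsConnectedLinearAlgebraicGroup G) {N Q : coordRing G} (hN : N ≠ 0) (hQ : Q ≠ 0)
    (c : G → Eˣ) (hc : ∀ b g : G, Q.1 (b * g) * N.1 g * c b = N.1 (b * g) * Q.1 g) :
    ∃ χ ∈ characterGroup G, ∀ g, χ g = c g := by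
  have := isDomain_coordRing hG
  have hmul : ∀ a b : G, c (a * b) = c a * c b := by
    intro a b
    obtain ⟨g, hg⟩ := coordRing_ne_zero_iff.mp (mul_ne_zero (mul_ne_zero (mul_ne_zero hN hQ)
      (mul_ne_zero (leftTranslate_ne_zero hN b) (leftTranslate_ne_zero hQ b)))
      (leftTranslate_ne_zero hQ (a * b)))
    change N.1 g * Q.1 g * (N.1 (b * g) * Q.1 (b * g)) * Q.1 (a * b * g) ≠ 0 at hg
    simp only [ne_eq, mul_eq_zero, not_or] at hg
    obtain ⟨⟨⟨h1, h2⟩, h3, h4⟩, h5⟩ := hg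
    have e1 := hc (a * b) g
    have e2 := hc a (b * g)
    have e3 := hc b g
    rw [← mul_assoc] at e2
    refine Units.ext ?_
    rw [Units.val_mul]
    have hne : Q.1 (a * b * g) * N.1 g * (N.1 (b * g) * Q.1 (b * g)) ≠ 0 := by
      simp [h1, h3, h4, h5]
    refine mul_left_cancel₀ hne ?_
    linear_combination (N.1 (b * g) * Q.1 (b * g)) * e1 - (Q.1 (b * g) * N.1 g * c b) * e2
      - (N.1 (a * b * g) * Q.1 (b * g)) * e3
  have hone : c 1 = 1 := by
    have := hmul 1 1
    rw [mul_one] at this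
    exact left_eq_mul.mp this
  refine ⟨⟨⟨c, hone⟩, hmul⟩, ?_, fun g => rfl⟩
  refine mem_coordRing_iff.mp (mem_coordRing_of_locally hG.isClosed fun b => ?_)
  obtain ⟨g, hg⟩ := coordRing_ne_zero_iff.mp (mul_ne_zero (leftTranslate_ne_zero hQ b) hN)
  change Q.1 (b * g) * N.1 g ≠ 0 at hg
  refine ⟨N.1 g • fun x => Q.1 (x * g), Subalgebra.smul_mem _ (mul_right_mem_coordRing Q.2 g) _,
    ?_, ?_⟩
  · simpa [mul_comm] using hg
  · have : (N.1 g • fun x => Q.1 (x * g)) * (fun x => (c x : E))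
        = Q.1 g • fun x => N.1 (x * g) := by
      funext x
      have := hc x g
      simp only [Pi.mul_apply, Pi.smul_apply, smul_eq_mul]
      linear_combination this
    change (N.1 g • fun x => Q.1 (x * g)) * (fun x => (c x : E)) ∈ coordRing G
    rw [this]
    exact Subalgebra.smul_mem _ (mul_right_mem_coordRing N.2 g) _

/-- The quotients of the left translates of a semi-invariant `F` by `F` are rational functions on
the affine space with a common denominator. -/
theorem exists_common_denominator [IsAlgClosed E] [CharZero E]
    (hG : IsConnectedLinearAlgebraicGroup G) (hreg : IsRegularAction (n := n) G) {ξ : Fin n → E}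
    (hξ : ξ ∈ genericPoints (n := n) G) {F : coordRing G} (hF : F ≠ 0) {ψ : G → E}
    (hψ : ∀ g h : G, h • ξ = ξ → F.1 (g * h) = ψ h * F.1 g) :
    ∃ (q : MvPolynomial (Fin n) E) (p : G → MvPolynomial (Fin n) E), q ≠ 0 ∧
      ∀ a g : G, MvPolynomial.eval (g • ξ) q * F.1 (a * g)
        = MvPolynomial.eval (g • ξ) (p a) * F.1 g := by
  classical
  have hdesc : ∀ a : G, ∃ d b : MvPolynomial (Fin n) E, d ≠ 0 ∧
      orbitHom hreg ξ d * leftTranslate a F = orbitHom hreg ξ b * F := fun a =>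
    exists_descent hG hreg hξ hF fun g h hh => by
      change F.1 (a * g) * F.1 (g * h) = F.1 g * F.1 (a * (g * h))
      rw [← mul_assoc, hψ _ _ hh, hψ _ _ hh]
      ring
  choose d b hd hdb using hdesc
  have hfin := finiteDimensional_span_mul_left F.2
  obtain ⟨s, hs, hspan⟩ := (Submodule.fg_span_iff_fg_span_finset_subset _).mp
    (Module.Finite.iff_fg.mp hfin)
  choose! t ht using fun x (hx : x ∈ s) => hs hx
  let q : MvPolynomial (Fin n) E := ∏ x ∈ s, d (t x)
  let W : Submodule E (G → E) :=
    { carrier := {f | ∃ p : MvPolynomial (Fin n) E, ∀ g : G,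
        MvPolynomial.eval (g • ξ) q * f g = MvPolynomial.eval (g • ξ) p * F.1 g}
      zero_mem' := ⟨0, fun g => by simp⟩
      add_mem' := by
        rintro f₁ f₂ ⟨p₁, h₁⟩ ⟨p₂, h₂⟩
        refine ⟨p₁ + p₂, fun g => ?_⟩
        rw [Pi.add_apply, mul_add, h₁, h₂, map_add, add_mul]
      smul_mem' := by
        rintro e f ⟨p, h⟩
        refine ⟨MvPolynomial.C e * p, fun g => ?_⟩
        rw [Pi.smul_apply, smul_eq_mul, mul_left_comm, h, map_mul, MvPolynomial.eval_C, mul_assoc] }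
  have hsW : Submodule.span E (s : Set (G → E)) ≤ W := by
    rw [Submodule.span_le]
    intro f hf
    refine ⟨(∏ x ∈ s.erase f, d (t x)) * b (t f), fun g => ?_⟩
    have h1 := congrFun (congrArg Subtype.val (hdb (t f))) g
    change MvPolynomial.eval (g • ξ) (d (t f)) * F.1 (t f * g)
      = MvPolynomial.eval (g • ξ) (b (t f)) * F.1 g at h1
    have h2 : F.1 (t f * g) = f g := congrFun (ht f hf) g
    rw [h2] at h1
    have h3 : q = (∏ x ∈ s.erase f, d (t x)) * d (t f) := (Finset.prod_erase_mul s _ hf).symm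
    rw [h3, map_mul, map_mul, mul_assoc, h1, mul_assoc]
  have hW : ∀ a : G, (fun g => F.1 (a * g)) ∈ W := fun a =>
    hsW (hspan ▸ Submodule.subset_span ⟨a, rfl⟩)
  choose p hp using hW
  exact ⟨q, p, Finset.prod_ne_zero_iff.mpr fun x _ => hd _, hp⟩

/-- The weight of a nonzero regular function on the group which is semi-invariant under right
translations by the stabiliser of a generic point extends to a character of the group. -/
theorem exists_character_of_right_semiinvariant [IsAlgClosed E] [CharZero E]
    (hG : IsConnectedLinearAlgebraicGroup G) (hreg : IsRegularAction (n := n) G) {ξ : Fin n → E}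
    (hξ : ξ ∈ genericPoints (n := n) G) {F : coordRing G} (hF : F ≠ 0) {ψ : G → E}
    (hψ : ∀ g h : G, h • ξ = ξ → F.1 (g * h) = ψ h * F.1 g) :
    ∃ χ ∈ characterGroup G, ∀ h : G, h • ξ = ξ → (χ h : E) = ψ h := by
  have := isDomain_coordRing hG
  have hinj := orbitHom_injective hreg hξ
  obtain ⟨q, p, hq, hp⟩ := exists_common_denominator hG hreg hξ hF hψ
  obtain ⟨D, hDp, hD⟩ := exists_gcd_of_family p
  have hcancel : ∀ u v : MvPolynomial (Fin n) E, (∀ g : G, MvPolynomial.eval (g • ξ) u * F.1 g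
      = MvPolynomial.eval (g • ξ) v * F.1 g) → u = v := fun u v h =>
    hinj (mul_right_cancel₀ hF (Subtype.ext (funext h)))
  have hp1 : p 1 = q := hcancel _ _ fun g => by rw [← hp, one_mul]
  have hD0 : D ≠ 0 := fun h => hq (by simpa [h, hp1] using hDp 1)
  have hcocycle : ∀ a b : G, translate hreg b q * p (a * b) = translate hreg b (p a) * p b :=
    fun a b => hcancel _ _ fun g => by
      have e1 := hp (a * b) g
      have e2 := hp a (b * g)
      have e3 := hp b g
      simp only [map_mul, eval_translate]
      rw [mul_smul, ← mul_assoc] at e2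
      linear_combination (-MvPolynomial.eval (b • g • ξ) q) * e1
        + MvPolynomial.eval (g • ξ) q * e2 + MvPolynomial.eval (b • g • ξ) (p a) * e3
  have hassoc : ∀ b : G, Associated (translate hreg b q * D) (translate hreg b D * p b) := by
    intro b
    refine associated_of_dvd_dvd ?_ (hD _ _ fun a => ?_)
    · have h1 : ∀ a, translate hreg b⁻¹ (translate hreg b q * D)
          ∣ translate hreg b⁻¹ (p b) * p a := fun a => by
        have h2 : translate hreg b q * D ∣ p b * translate hreg b (p a) := by
          rw [mul_comm (p b), ← hcocycle]
          exact mul_dvd_mul_left _ (hDp _)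
        simpa using map_dvd (translate hreg b⁻¹) h2
      have h3 := map_dvd (translate hreg b) (hD _ _ h1)
      rw [translate_translate_inv, map_mul, translate_translate_inv] at h3
      rwa [mul_comm (p b)] at h3
    · have := hcocycle (a * b⁻¹) b
      rw [inv_mul_cancel_right] at this
      rw [this]
      exact mul_dvd_mul_right (map_dvd _ (hDp _)) _
  have hconst : ∀ b : G, ∃ c : Eˣ, translate hreg b q * D * MvPolynomial.C (c : E)
      = translate hreg b D * p b := fun b => by
    obtain ⟨u, hu⟩ := hassoc b
    obtain ⟨r, hr, hur⟩ := MvPolynomial.isUnit_iff_eq_C_of_isReduced.mp u.isUnit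
    exact ⟨hr.unit, by rw [IsUnit.unit_spec, ← hur, hu]⟩
  choose c hc using hconst
  have hQ0 : orbitHom hreg ξ q ≠ 0 := (map_ne_zero_iff _ hinj).mpr hq
  have hN0 : orbitHom hreg ξ D * F ≠ 0 := mul_ne_zero ((map_ne_zero_iff _ hinj).mpr hD0) hF
  have hstar : ∀ b g : G, (orbitHom hreg ξ q).1 (b * g) * (orbitHom hreg ξ D * F).1 g * c b
      = (orbitHom hreg ξ D * F).1 (b * g) * (orbitHom hreg ξ q).1 g := fun b g => by
    have e1 := congrArg (MvPolynomial.eval (g • ξ)) (hc b)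
    have e2 := hp b g
    simp only [map_mul, eval_translate, MvPolynomial.eval_C] at e1
    change MvPolynomial.eval ((b * g) • ξ) q * (MvPolynomial.eval (g • ξ) D * F.1 g) * c b
      = (MvPolynomial.eval ((b * g) • ξ) D * F.1 (b * g)) * MvPolynomial.eval (g • ξ) q
    rw [mul_smul]
    linear_combination F.1 g * e1 - MvPolynomial.eval (b • g • ξ) D * e2
  obtain ⟨χ, hχ, hχc⟩ := exists_character_of_left_semiinvariant hG hN0 hQ0 c hstar
  refine ⟨χ, hχ, fun h hh => ?_⟩
  obtain ⟨g, hg⟩ := coordRing_ne_zero_iff.mp (mul_ne_zero hN0 hQ0)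
  have e := hstar (g * h * g⁻¹) g
  rw [inv_mul_cancel_right] at e
  have hconj : c (g * h * g⁻¹) = χ h := by
    rw [← hχc, map_mul, map_mul, map_inv, mul_comm, inv_mul_cancel_left]
  rw [hconj] at e
  refine mul_left_cancel₀ hg ?_
  change (MvPolynomial.eval ((g * h) • ξ) q * (MvPolynomial.eval (g • ξ) D * F.1 g)) * χ h
    = MvPolynomial.eval ((g * h) • ξ) D * F.1 (g * h) * MvPolynomial.eval (g • ξ) q at e
  change (MvPolynomial.eval (g • ξ) D * F.1 g) * MvPolynomial.eval (g • ξ) q * χ h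
    = (MvPolynomial.eval (g • ξ) D * F.1 g) * MvPolynomial.eval (g • ξ) q * ψ h
  rw [mul_smul, hh, hψ _ _ hh] at e
  linear_combination e

end Extension

end Prehomogeneous

section LinearAlgebra

/-- Linearly independent functions are linearly independent on a suitable finite set of points. -/
theorem exists_det_ne_zero_of_linearIndependent {E X : Type*} [Field E] {r : ℕ}
    {v : Fin r → X → E} (hv : LinearIndependent E v) :
    ∃ a : Fin r → X, (Matrix.of fun j i => v i (a j)).det ≠ 0 := by
  let w : X → Fin r → E := fun x i => v i x
  have hspan : Submodule.span E (Set.range w) = ⊤ := by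
    by_contra hne
    obtain ⟨f, hf, hle⟩ := Submodule.exists_le_ker_of_lt_top _ (lt_top_iff_ne_top.mpr hne)
    apply hf
    have hzero : ∑ i, f (Pi.single i 1) • v i = 0 := by
      funext x
      have h1 : f (w x) = 0 := hle (Submodule.subset_span ⟨x, rfl⟩)
      rw [pi_eq_sum_univ' (w x), map_sum] at h1
      simpa [w, mul_comm, Pi.single_apply, eq_comm] using h1
    have h0 := Fintype.linearIndependent_iff.mp hv _ hzero
    refine LinearMap.pi_ext' fun i => LinearMap.ext_ring ?_
    simpa using h0 i
  obtain ⟨f, hfmem, -, hfli⟩ := Submodule.exists_fun_fin_finrank_span_eq E (Set.range w)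
  have hr : Module.finrank E (Submodule.span E (Set.range w)) = r := by
    rw [hspan, finrank_top, Module.finrank_fin_fun]
  choose a ha using hfmem
  let e := finCongr hr.symm
  refine ⟨fun j => a (e j), ?_⟩
  have hli : LinearIndependent E fun j => (Matrix.of fun j i => v i (a (e j))).row j := by
    have heq : (fun j => (Matrix.of fun j i => v i (a (e j))).row j) = f ∘ e :=
      funext fun j => ha (e j)
    rw [heq]
    exact hfli.comp e e.injective
  exact ((Matrix.isUnit_iff_isUnit_det _).mp
    (Matrix.linearIndependent_rows_iff_isUnit.mp hli)).ne_zero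

theorem ker_le_comap_ker {E M : Type*} [Field E] [AddCommGroup M] [Module E M] {ev : M →ₗ[E] E}
    {T : M →ₗ[E] M} {x : E} (hT : ∀ y, ev (T y) = x * ev y) :
    LinearMap.ker ev ≤ (LinearMap.ker ev).comap T := fun y hy => by
  rw [Submodule.mem_comap, LinearMap.mem_ker, hT, LinearMap.mem_ker.mp hy, mul_zero]

theorem det_eq_det_restrict_ker_mul {E M : Type*} [Field E] [AddCommGroup M] [Module E M]
    [FiniteDimensional E M] {ev : M →ₗ[E] E} (hev : Function.Surjective ev) {T : M →ₗ[E] M} {x : E}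
    (hT : ∀ y, ev (T y) = x * ev y) :
    LinearMap.det T = LinearMap.det (T.restrict (ker_le_comap_ker hT)) * x := by
  rw [LinearMap.det_eq_det_mul_det (LinearMap.ker ev) T (ker_le_comap_ker hT)]
  congr 1
  have hsmul : (LinearMap.ker ev).mapQ (LinearMap.ker ev) T (ker_le_comap_ker hT)
      = x • (LinearMap.id : (M ⧸ LinearMap.ker ev) →ₗ[E] M ⧸ LinearMap.ker ev) := by
    refine Submodule.linearMap_qext _ (LinearMap.ext fun y => ?_)
    change Submodule.Quotient.mk (p := LinearMap.ker ev) (T y)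
      = x • Submodule.Quotient.mk (p := LinearMap.ker ev) y
    rw [← Submodule.Quotient.mk_smul, Submodule.Quotient.eq, LinearMap.mem_ker, map_sub, map_smul,
      hT, smul_eq_mul, sub_self]
  have hrank : Module.finrank E (M ⧸ LinearMap.ker ev) = 1 := by
    rw [(ev.quotKerEquivOfSurjective hev).finrank_eq, Module.finrank_self]
  rw [hsmul, LinearMap.det_smul, hrank, LinearMap.det_id, pow_one, mul_one]

end LinearAlgebra

namespace Prehomogeneous

section Surjectivity

variable {E : Type*} [Field E] {m n : ℕ} {G : Subgroup (GL (Fin m) E)}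

/-- The determinant of right translations on a finite-dimensional space of regular functions is
the weight of a nonzero regular function. -/
theorem exists_semiinvariant_det {M : Type*} [AddCommGroup M] [Module E M] [FiniteDimensional E M]
    (j : M →ₗ[E] (G → E)) (hj : Function.Injective j) (hreg : ∀ x, j x ∈ coordRing G) :
    ∃ F : coordRing G, F ≠ 0 ∧ ∀ (h : G) (T : M →ₗ[E] M), (∀ x g, j (T x) g = j x (g * h)) →
      ∀ g, F.1 (g * h) = LinearMap.det T * F.1 g := by
  let b := Module.finBasis E M
  obtain ⟨a, ha⟩ := exists_det_ne_zero_of_linearIndependent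
    (b.linearIndependent.map' j (LinearMap.ker_eq_bot.mpr hj))
  let A : Matrix (Fin (Module.finrank E M)) (Fin (Module.finrank E M)) (coordRing G) :=
    Matrix.of fun k i => leftTranslate (a k) ⟨j (b i), hreg _⟩
  let ev : G → coordRing G →+* E := fun g => (Pi.evalRingHom (fun _ => E) g).comp
    (coordRing G).val.toRingHom
  have hA : ∀ g, A.det.1 g = (Matrix.of fun k i => j (b i) (a k * g)).det := fun g => by
    change ev g A.det = _
    rw [RingHom.map_det]
    rfl
  refine ⟨A.det, coordRing_ne_zero_iff.mpr ⟨1, ?_⟩, fun h T hT g => ?_⟩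
  · rw [hA]
    simpa using ha
  · rw [hA, hA, ← LinearMap.det_toMatrix b, mul_comm, ← Matrix.det_mul]
    congr 1
    ext k i
    have h1 : T (b i) = ∑ l, LinearMap.toMatrix b b T l i • b l := by
      simp only [LinearMap.toMatrix_apply]
      exact (b.sum_repr _).symm
    rw [Matrix.of_apply, ← mul_assoc, ← hT, h1, Matrix.mul_apply, map_sum, Finset.sum_apply]
    refine Finset.sum_congr rfl fun l _ => ?_
    rw [map_smul, Pi.smul_apply, smul_eq_mul, mul_comm, Matrix.of_apply]

variable [MulAction G (Fin n → E)]

theorem mem_stab_iff {ξ : Fin n → E} {g : G} : g.1 ∈ stab G ξ ↔ g • ξ = ξ := by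
  constructor
  · rintro ⟨h, hh, hhg⟩
    have : h = g := Subtype.ext hhg
    exact this ▸ hh
  · exact fun h => ⟨g, h, rfl⟩

/-- All characters of the stabiliser of a generic point extend to the group. -/
theorem restrict_surjective [IsAlgClosed E] [CharZero E]
    (hG : IsConnectedLinearAlgebraicGroup G) (hreg : IsRegularAction (n := n) G) {ξ : Fin n → E}
    (hξ : ξ ∈ genericPoints (n := n) G) : Function.Surjective (restrict (stab_le G ξ)) := by
  intro χ
  obtain ⟨P, hP⟩ := χ.2
  let f₀ : G → E := fun g => MvPolynomial.eval (glCoord g.1) P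
  have hf₀ : f₀ ∈ coordRing G := mem_coordRing_iff.mpr ⟨P, fun _ => rfl⟩
  let X : MulAction.stabilizer G ξ → E := fun h => χ.1 ⟨h.1.1, mem_stab_iff.mpr h.2⟩
  have hX : ∀ h : MulAction.stabilizer G ξ, f₀ h.1 = X h := fun h =>
    (hP ⟨h.1.1, mem_stab_iff.mpr h.2⟩).symm
  have hXmul : ∀ h k, X (h * k) = X h * X k := fun h k => by
    simp only [X, ← Units.val_mul, ← map_mul]
    rfl
  have hX1 : X 1 = 1 := by
    have h1 : (⟨((1 : MulAction.stabilizer G ξ) : G).1, mem_stab_iff.mpr (1 :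
      MulAction.stabilizer G ξ).2⟩ : stab G ξ) = 1 := rfl
    simp only [X, h1, map_one, Units.val_one]
  let ρ : G → (G → E) →ₗ[E] (G → E) := fun h => LinearMap.funLeft E E fun g => g * h
  have hρ : ∀ h f g, ρ h f g = f (g * h) := fun _ _ _ => rfl
  let M : Submodule E (G → E) :=
    Submodule.span E (Set.range fun h : MulAction.stabilizer G ξ => ρ h.1 f₀)
  have hMfin : FiniteDimensional E M := by
    have := finiteDimensional_span_mul_right hf₀
    refine Submodule.finiteDimensional_of_le (S₂ := Submodule.span E (Set.range fun a : G =>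
      fun g : G => f₀ (g * a))) (Submodule.span_mono ?_)
    rintro _ ⟨h, rfl⟩
    exact ⟨h.1, rfl⟩
  have hMreg : ∀ x : M, x.1 ∈ coordRing G := fun x => by
    have hle : M ≤ Subalgebra.toSubmodule (coordRing G) := Submodule.span_le.mpr (by
      rintro _ ⟨h, rfl⟩
      exact mul_right_mem_coordRing hf₀ h.1)
    exact hle x.2
  have hMstab : ∀ h : MulAction.stabilizer G ξ, M ≤ M.comap (ρ h.1) := fun h =>
    Submodule.span_le.mpr (by
      rintro _ ⟨k, rfl⟩
      refine Submodule.subset_span ⟨h * k, funext fun g => ?_⟩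
      simp [hρ, mul_assoc])
  have hMval : ∀ (x : M) (h : MulAction.stabilizer G ξ), x.1 h.1 = X h * x.1 1 := by
    intro x h
    have hle : M ≤ LinearMap.ker ((LinearMap.proj h.1 : (G → E) →ₗ[E] E)
        - X h • (LinearMap.proj 1 : (G → E) →ₗ[E] E)) := Submodule.span_le.mpr (by
      rintro _ ⟨k, rfl⟩
      change f₀ (h.1 * k.1) - X h * f₀ (1 * k.1) = 0
      rw [one_mul, hX k, sub_eq_zero]
      exact (hX (h * k)).trans (hXmul h k))
    have := hle x.2
    change x.1 h.1 - X h * x.1 1 = 0 at this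
    exact sub_eq_zero.mp this
  let ev : M →ₗ[E] E := (LinearMap.proj (1 : G) : (G → E) →ₗ[E] E).comp M.subtype
  have hev : Function.Surjective ev := by
    have hmem : ρ (1 : MulAction.stabilizer G ξ).1 f₀ ∈ M := Submodule.subset_span ⟨1, rfl⟩
    have h1 : ev ⟨_, hmem⟩ = 1 := by
      change f₀ (1 * (1 : MulAction.stabilizer G ξ).1) = 1
      rw [one_mul, hX, hX1]
    intro e
    exact ⟨e • ⟨_, hmem⟩, by rw [map_smul, h1, smul_eq_mul, mul_one]⟩
  let K : Submodule E M := LinearMap.ker ev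
  let T : MulAction.stabilizer G ξ → M →ₗ[E] M := fun h => (ρ h.1).restrict (hMstab h)
  have hT : ∀ h x g, (T h x).1 g = x.1 (g * h.1) := fun _ _ _ => rfl
  have hTev : ∀ h x, ev (T h x) = X h * ev x := fun h x => by
    change x.1 (1 * h.1) = X h * x.1 1
    rw [one_mul, hMval]
  let TK : MulAction.stabilizer G ξ → K →ₗ[E] K := fun h =>
    (T h).restrict (ker_le_comap_ker (hTev h))
  have hdet : ∀ h, LinearMap.det (T h) = LinearMap.det (M := K) (TK h) * X h := fun h =>
    det_eq_det_restrict_ker_mul hev (hTev h)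
  obtain ⟨F₁, hF₁, hF₁T⟩ := exists_semiinvariant_det M.subtype M.injective_subtype hMreg
  let j : K →ₗ[E] (G → E) := M.subtype.comp K.subtype
  obtain ⟨F₂, hF₂, hF₂T⟩ := exists_semiinvariant_det j
    (M.injective_subtype.comp K.injective_subtype) fun x : K => hMreg x.1
  classical
  obtain ⟨χ₁, hχ₁, h₁⟩ := exists_character_of_right_semiinvariant hG hreg hξ hF₁
    (ψ := fun h => if hh : h • ξ = ξ then LinearMap.det (T ⟨h, hh⟩) else 0) fun g h hh => by
      rw [dif_pos hh]
      exact hF₁T h _ (fun _ _ => rfl) g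
  obtain ⟨χ₂, hχ₂, h₂⟩ := exists_character_of_right_semiinvariant hG hreg hξ hF₂
    (ψ := fun h => if hh : h • ξ = ξ then LinearMap.det (M := K) (TK ⟨h, hh⟩) else 0)
    fun g h hh => by
      rw [dif_pos hh]
      exact hF₂T h _ (fun _ _ => rfl) g
  refine ⟨⟨χ₁, hχ₁⟩ * ⟨χ₂, hχ₂⟩⁻¹, Subtype.ext (MonoidHom.ext fun h => Units.ext ?_)⟩
  have hhG : h.1 ∈ G := stab_le G ξ h.2
  have hh : (⟨h.1, hhG⟩ : G) • ξ = ξ := mem_stab_iff.mp h.2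
  have e₁ := h₁ ⟨h.1, hhG⟩ hh
  have e₂ := h₂ ⟨h.1, hhG⟩ hh
  rw [dif_pos hh] at e₁ e₂
  rw [hdet, ← e₂] at e₁
  change ((χ₁ ⟨h.1, hhG⟩ * (χ₂ ⟨h.1, hhG⟩)⁻¹ : Eˣ) : E) = χ.1 h
  rw [Units.val_mul, e₁, mul_comm, Units.inv_mul_cancel_left]

end Surjectivity

section Hypersurfaces

attribute [local instance] zariski

open TopologicalSpace

variable {E : Type*} [Field E] {n : ℕ}

theorem isClosed_zeros {σ : Type*} (p : MvPolynomial σ E) :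
    IsClosed {x : σ → E | MvPolynomial.eval x p = 0} :=
  isClosed_of_closure_subset fun _ hx => mem_closure_zariski_iff.mp hx p fun _ hy => hy

theorem exists_eval_ne_zero {σ : Type*} {Z : Set (σ → E)} (hZ : IsClosed Z) {x : σ → E}
    (hx : x ∉ Z) :
    ∃ p : MvPolynomial σ E, (∀ y ∈ Z, MvPolynomial.eval y p = 0) ∧ MvPolynomial.eval x p ≠ 0 := by
  by_contra! h
  exact hx (hZ.closure_eq ▸ mem_closure_zariski_iff.mpr h)

theorem isPrime_vanishingIdeal {σ : Type*} {Z : Set (σ → E)} (hZ : IsIrreducible Z) :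
    (MvPolynomial.vanishingIdeal E Z : Ideal (MvPolynomial σ E)).IsPrime := by
  refine ⟨(Ideal.ne_top_iff_one _).mpr fun h => ?_, fun {p q} hpq => ?_⟩
  · obtain ⟨x, hx⟩ := hZ.nonempty
    simpa using h x hx
  · have hcov : Z ⊆ {x | MvPolynomial.eval x p = 0} ∪ {x | MvPolynomial.eval x q = 0} :=
      fun x hx => by
        have := hpq x hx
        rw [MvPolynomial.aeval_eq_eval, map_mul] at this
        exact mul_eq_zero.mp this
    rcases isPreirreducible_iff_isClosed_union_isClosed.mp hZ.isPreirreducible _ _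
      (isClosed_zeros p) (isClosed_zeros q) hcov with h | h
    · exact Or.inl fun x hx => h hx
    · exact Or.inr fun x hx => h hx

variable [IsAlgClosed E]

theorem dvd_of_eval_eq_zero {σ : Type*} [Finite σ] {π p : MvPolynomial σ E} (hπ : Prime π)
    (h : ∀ x, MvPolynomial.eval x π = 0 → MvPolynomial.eval x p = 0) : π ∣ p := by
  have : (Ideal.span {π}).IsPrime := (Ideal.span_singleton_prime hπ.ne_zero).mpr hπ
  rw [← Ideal.mem_span_singleton,
    ← MvPolynomial.IsPrime.vanishingIdeal_zeroLocus (K := E) (Ideal.span {π})]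
  exact fun x hx => h x (hx π (Ideal.mem_span_singleton_self π))

/-- The hypersurface defined by a prime polynomial. -/
def hypersurface {π : MvPolynomial (Fin n) E} (hπ : Prime π) : IrreducibleCloseds (Fin n → E) where
  carrier := {x | MvPolynomial.eval x π = 0}
  isClosed' := isClosed_zeros π
  isIrreducible' := by
    refine ⟨?_, isPreirreducible_iff_isClosed_union_isClosed.mpr fun Z₁ Z₂ h₁ h₂ hcov => ?_⟩
    · by_contra hne
      refine hπ.not_isUnit (isUnit_of_dvd_one (dvd_of_eval_eq_zero hπ fun x hx => ?_))
      exact absurd ⟨x, hx⟩ hne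
    · by_contra! h
      obtain ⟨⟨x₁, hx₁, hn₁⟩, x₂, hx₂, hn₂⟩ := And.imp Set.not_subset.mp Set.not_subset.mp h
      obtain ⟨p₁, hp₁, hpx₁⟩ := exists_eval_ne_zero h₁ hn₁
      obtain ⟨p₂, hp₂, hpx₂⟩ := exists_eval_ne_zero h₂ hn₂
      have hdvd : π ∣ p₁ * p₂ := dvd_of_eval_eq_zero hπ fun x hx => by
        rcases hcov hx with h | h
        · rw [map_mul, hp₁ x h, zero_mul]
        · rw [map_mul, hp₂ x h, mul_zero]
      rcases hπ.dvd_or_dvd hdvd with ⟨k, rfl⟩ | ⟨k, rfl⟩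
      · exact hpx₁ (by rw [map_mul, show MvPolynomial.eval x₁ π = 0 from hx₁, zero_mul])
      · exact hpx₂ (by rw [map_mul, show MvPolynomial.eval x₂ π = 0 from hx₂, zero_mul])

/-- A proper irreducible closed subset is contained in the hypersurface of a prime polynomial. -/
theorem exists_le_hypersurface (Z : IrreducibleCloseds (Fin n → E))
    (hZ : (Z : Set (Fin n → E)) ≠ Set.univ) :
    ∃ (π : MvPolynomial (Fin n) E) (hπ : Prime π), Z ≤ hypersurface hπ := by
  have hprime := isPrime_vanishingIdeal Z.isIrreducible
  have hne : (MvPolynomial.vanishingIdeal E (Z : Set (Fin n → E))) ≠ ⊥ := fun hbot => by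
    obtain ⟨x, hx⟩ := (Set.ne_univ_iff_exists_notMem _).mp hZ
    obtain ⟨p, hp, hpx⟩ := exists_eval_ne_zero Z.isClosed hx
    have hmem : p ∈ MvPolynomial.vanishingIdeal E (Z : Set (Fin n → E)) := fun y hy => hp y hy
    rw [hbot, Ideal.mem_bot] at hmem
    exact hpx (by rw [hmem, map_zero])
  obtain ⟨π, hmem, hπ⟩ := hprime.exists_mem_prime_of_ne_bot hne
  exact ⟨π, hπ, fun x hx => hmem x hx⟩

/-- An irreducible closed set strictly larger than a hypersurface is the whole space. -/
theorem eq_univ_of_hypersurface_lt {π : MvPolynomial (Fin n) E} (hπ : Prime π)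
    {Y : IrreducibleCloseds (Fin n → E)} (hY : hypersurface hπ < Y) :
    (Y : Set (Fin n → E)) = Set.univ := by
  by_contra hne
  obtain ⟨ρ, hρ, hle⟩ := exists_le_hypersurface Y hne
  have hdvd : π ∣ ρ := dvd_of_eval_eq_zero hπ fun x hx => hle (hY.le hx)
  have hass := hπ.associated_of_dvd hρ hdvd
  refine hY.not_ge fun x hx => ?_
  obtain ⟨k, hk⟩ := hass.symm.dvd
  change MvPolynomial.eval x π = 0
  rw [hk, map_mul, show MvPolynomial.eval x ρ = 0 from hle hx, zero_mul]

theorem coheight_hypersurface_le {π : MvPolynomial (Fin n) E} (hπ : Prime π) :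
    Order.coheight (hypersurface hπ) ≤ 1 := by
  refine Order.coheight_le_coe_iff (n := 1) |>.mpr fun Y hY => ?_
  have hmax : IsMax Y := fun Y' _ x _ => by
    have : x ∈ (Y : Set (Fin n → E)) := by
      rw [eq_univ_of_hypersurface_lt hπ hY]
      trivial
    exact this
  rw [Order.coheight_eq_zero.mpr hmax]
  exact zero_lt_one

theorem hypersurface_ne_univ {π : MvPolynomial (Fin n) E} (hπ : Prime π) :
    (hypersurface hπ : Set (Fin n → E)) ≠ Set.univ := fun h => by
  have : Infinite E := IsAlgClosed.instInfinite
  refine hπ.ne_zero (MvPolynomial.funext fun x => ?_)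
  have : x ∈ (hypersurface hπ : Set (Fin n → E)) := h ▸ Set.mem_univ x
  rw [map_zero]
  exact this

theorem isIrreducible_univ_zariski : IsIrreducible (Set.univ : Set (Fin n → E)) := by
  have : Infinite E := IsAlgClosed.instInfinite
  refine ⟨⟨0, trivial⟩, isPreirreducible_iff_isClosed_union_isClosed.mpr
    fun Z₁ Z₂ h₁ h₂ hcov => ?_⟩
  by_contra! h
  obtain ⟨⟨x₁, -, hn₁⟩, x₂, -, hn₂⟩ := And.imp Set.not_subset.mp Set.not_subset.mp h
  obtain ⟨p₁, hp₁, hpx₁⟩ := exists_eval_ne_zero h₁ hn₁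
  obtain ⟨p₂, hp₂, hpx₂⟩ := exists_eval_ne_zero h₂ hn₂
  have h0 : p₁ * p₂ = 0 := MvPolynomial.funext fun x => by
    rcases hcov (Set.mem_univ x) with h | h
    · rw [map_mul, hp₁ x h, zero_mul, map_zero]
    · rw [map_mul, hp₂ x h, mul_zero, map_zero]
  rcases mul_eq_zero.mp h0 with rfl | rfl
  · exact hpx₁ (map_zero _)
  · exact hpx₂ (map_zero _)

/-- A proper irreducible closed set of codimension at most one is a hypersurface. -/
theorem eq_hypersurface_of_coheight_le {Z : IrreducibleCloseds (Fin n → E)}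
    (hZ : (Z : Set (Fin n → E)) ≠ Set.univ) (hco : Order.coheight Z ≤ 1) :
    ∃ (π : MvPolynomial (Fin n) E) (hπ : Prime π), Z = hypersurface hπ := by
  obtain ⟨π, hπ, hle⟩ := exists_le_hypersurface Z hZ
  refine ⟨π, hπ, hle.eq_of_not_lt fun hlt => ?_⟩
  let T : IrreducibleCloseds (Fin n → E) := ⟨Set.univ, isIrreducible_univ_zariski, isClosed_univ⟩
  have hT : hypersurface hπ < T := lt_of_le_of_ne (fun x _ => Set.mem_univ x) fun h =>
    hypersurface_ne_univ hπ (congrArg IrreducibleCloseds.carrier h)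
  have h1 := Order.coheight_add_one_le hT
  have h2 := Order.coheight_add_one_le hlt
  have h3 : (1 : ℕ∞) + 1 ≤ 1 :=
    (add_le_add_left ((le_add_self).trans h1) 1).trans (h2.trans hco)
  exact absurd h3 (by decide)

theorem one_lt_codim_iff (S : Set (Fin n → E)) (hS : S ≠ Set.univ) :
    1 < codim S ↔ ∀ (π : MvPolynomial (Fin n) E), Prime π →
      ∃ x, MvPolynomial.eval x π = 0 ∧ x ∉ S := by
  constructor
  · intro h π hπ
    by_contra! hsub
    have hle : codim S ≤ Order.coheight (hypersurface hπ) := iInf₂_le (hypersurface hπ) hsub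
    exact absurd (hle.trans (coheight_hypersurface_le hπ)) h.not_ge
  · intro h
    have h2 : (2 : ℕ∞) ≤ codim S := le_iInf₂ fun Z hZ => by
      by_contra hlt
      have hco : Order.coheight Z ≤ 1 := Order.le_of_lt_add_one (not_le.mp hlt)
      obtain ⟨π, hπ, rfl⟩ := eq_hypersurface_of_coheight_le
        (fun hu => hS (Set.univ_subset_iff.mp (hu ▸ hZ))) hco
      obtain ⟨x, hx, hxS⟩ := h π hπ
      exact hxS (hZ hx)
    exact lt_of_lt_of_le (by decide) h2

end Hypersurfaces

section RelativeInvariants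

variable {E : Type*} [Field E] {m n : ℕ} {G : Subgroup (GL (Fin m) E)}
  [MulAction G (Fin n → E)]

theorem smul_mem_genericPoints {x : Fin n → E} (hx : x ∈ genericPoints (n := n) G) (g : G) :
    g • x ∈ genericPoints (n := n) G := by
  change @Dense _ (zariski E (Fin n)) (MulAction.orbit G (g • x))
  rw [MulAction.orbit_smul]
  exact hx

/-- A nonzero polynomial whose zeros form a stable set has no generic zeros. -/
theorem eval_ne_zero_of_dvd_translate [Infinite E] (hreg : IsRegularAction (n := n) G)
    {p : MvPolynomial (Fin n) E} (hp : p ≠ 0) (hdvd : ∀ g : G, p ∣ translate hreg g p)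
    {x : Fin n → E} (hx : x ∈ genericPoints (n := n) G) : MvPolynomial.eval x p ≠ 0 := by
  intro h0
  refine hp (orbitHom_injective hreg hx (Subtype.ext (funext fun g => ?_)))
  obtain ⟨k, hk⟩ := hdvd g
  have := congrArg (MvPolynomial.eval x) hk
  rw [map_mul, h0, zero_mul, eval_translate] at this
  rw [orbitHom_apply, this, map_zero]
  rfl

theorem hasValueAt_div {p q : MvPolynomial (Fin n) E} {x : Fin n → E}
    (hq : MvPolynomial.eval x q ≠ 0) :
    HasValueAt (algebraMap _ (RationalFunctions E n) p / algebraMap _ _ q) x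
      (MvPolynomial.eval x p / MvPolynomial.eval x q) :=
  ⟨p, q, hq, rfl, rfl⟩

theorem algebraMap_rationalFunctions_ne_zero {p : MvPolynomial (Fin n) E} (hp : p ≠ 0) :
    algebraMap _ (RationalFunctions E n) p ≠ 0 :=
  (map_ne_zero_iff _ (IsFractionRing.injective _ _)).mpr hp

theorem isRelativeInvariant_div [Infinite E] (hreg : IsRegularAction (n := n) G)
    {p q : MvPolynomial (Fin n) E} (hp : p ≠ 0) (hq : q ≠ 0) {χ : G →* Eˣ}
    (hχ : χ ∈ characterGroup G)
    (h : ∀ g : G, translate hreg g p * q = MvPolynomial.C (χ g : E) * p * translate hreg g q) :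
    IsRelativeInvariant G
      (algebraMap _ (RationalFunctions E n) p / algebraMap _ (RationalFunctions E n) q) := by
  refine ⟨div_ne_zero (algebraMap_rationalFunctions_ne_zero hp)
    (algebraMap_rationalFunctions_ne_zero hq), χ, hχ, ?_⟩
  rintro g x _ _ ⟨p₁, q₁, hq₁, hf₁, rfl⟩ ⟨p₂, q₂, hq₂, hf₂, rfl⟩
  have hcross : ∀ {p' q' : MvPolynomial (Fin n) E}, q' ≠ 0 →
      algebraMap _ (RationalFunctions E n) p / algebraMap _ (RationalFunctions E n) q
        = algebraMap _ (RationalFunctions E n) p' / algebraMap _ (RationalFunctions E n) q' →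
      p * q' = p' * q := fun hq' hf => by
    rw [div_eq_div_iff (algebraMap_rationalFunctions_ne_zero hq)
      (algebraMap_rationalFunctions_ne_zero hq'), ← map_mul, ← map_mul] at hf
    exact IsFractionRing.injective _ _ hf
  have e₁ := hcross (fun h0 => hq₁ (by rw [h0, map_zero])) hf₁
  have e₂ := congrArg (translate hreg g)
    (hcross (fun h0 => hq₂ (by rw [h0, map_zero])) hf₂)
  rw [map_mul, map_mul] at e₂
  have hτq : translate hreg g q ≠ 0 :=
    (map_ne_zero_iff _ (translate_injective hreg g)).mpr hq
  have key : translate hreg g p₂ * q₁ = MvPolynomial.C (χ g : E) * translate hreg g q₂ * p₁ := by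
    refine mul_right_cancel₀ (mul_ne_zero hq hτq) ?_
    linear_combination (-q₁ * q) * e₂ + (translate hreg g q₂ * q₁) * h g
      + (MvPolynomial.C (χ g : E) * translate hreg g q₂ * translate hreg g q) * e₁
  have hkey := congrArg (MvPolynomial.eval x) key
  simp only [map_mul, eval_translate, MvPolynomial.eval_C] at hkey
  field_simp
  linear_combination hkey

/-- A relative invariant is a quotient of coprime polynomials which are relatively invariant. -/
theorem IsRelativeInvariant.exists_reduced [Infinite E] (hreg : IsRegularAction (n := n) G)
    {f : RationalFunctions E n} (hf : IsRelativeInvariant G f) :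
    ∃ p q : MvPolynomial (Fin n) E, p ≠ 0 ∧ q ≠ 0 ∧
      f = algebraMap _ (RationalFunctions E n) p / algebraMap _ (RationalFunctions E n) q ∧
      (∀ g : G, p ∣ translate hreg g p) ∧ ∀ g : G, q ∣ translate hreg g q := by
  obtain ⟨hf0, χ, -, h⟩ := hf
  obtain ⟨p, ⟨q, hq⟩, hpq, hmk⟩ := IsFractionRing.exists_reduced_fraction
    (A := MvPolynomial (Fin n) E) f
  have hq0 : q ≠ 0 := nonZeroDivisors.ne_zero hq
  rw [IsFractionRing.mk'_eq_div] at hmk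
  have hp0 : p ≠ 0 := fun h0 => hf0 (by rw [← hmk, h0, map_zero, zero_div])
  have key : ∀ g : G, translate hreg g p * q = MvPolynomial.C (χ g : E) * p
      * translate hreg g q := fun g => by
    have hτq : translate hreg g q ≠ 0 :=
      (map_ne_zero_iff _ (translate_injective hreg g)).mpr hq0
    refine mul_right_cancel₀ (mul_ne_zero hq0 hτq) (MvPolynomial.funext fun x => ?_)
    by_cases hx : MvPolynomial.eval x q = 0
    · simp [hx]
    by_cases hgx : MvPolynomial.eval (g • x) q = 0
    · simp [hgx]
    have := h g x _ _ (hmk ▸ hasValueAt_div hx) (hmk ▸ hasValueAt_div hgx)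
    field_simp at this
    simp only [map_mul, eval_translate, MvPolynomial.eval_C]
    linear_combination (MvPolynomial.eval x q
      * MvPolynomial.eval (g • x) q) * this
  refine ⟨p, q, hp0, hq0, hmk.symm, fun g => ?_, fun g => ?_⟩
  · refine hpq.dvd_of_dvd_mul_right ?_
    rw [key]
    exact ⟨MvPolynomial.C (χ g : E) * translate hreg g q, by ring⟩
  · refine hpq.symm.dvd_of_dvd_mul_left (y := p) ?_
    have hunit : IsUnit (MvPolynomial.C (χ g : E) : MvPolynomial (Fin n) E) :=
      (χ g).isUnit.map MvPolynomial.C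
    refine (hunit.dvd_mul_left).mp ?_
    rw [← mul_assoc, ← key]
    exact dvd_mul_left _ _

theorem algebraMap_C_eq (c : E) : algebraMap (MvPolynomial (Fin n) E) (RationalFunctions E n)
    (MvPolynomial.C c)    = algebraMap E (RationalFunctions E n) c := by
  rw [← MvPolynomial.algebraMap_eq, ← IsScalarTower.algebraMap_apply]

/-- If restriction of characters to the stabiliser of a generic point is injective, then all
relative invariants are constant. -/
theorem constant_of_restrict_injective [Infinite E] (hreg : IsRegularAction (n := n) G)
    {ξ : Fin n → E} (hξ : ξ ∈ genericPoints (n := n) G)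
    (hinj : Function.Injective (restrict (stab_le G ξ))) {f : RationalFunctions E n}
    (hf : IsRelativeInvariant G f) : ∃ c : E, f = algebraMap E (RationalFunctions E n) c := by
  obtain ⟨p, q, hp0, hq0, rfl, hp, hq⟩ := hf.exists_reduced hreg
  obtain ⟨-, χ, hχ, h⟩ := hf
  have hpne : ∀ g : G, MvPolynomial.eval (g • ξ) p ≠ 0 := fun g =>
    eval_ne_zero_of_dvd_translate hreg hp0 hp (smul_mem_genericPoints hξ g)
  have hqne : ∀ g : G, MvPolynomial.eval (g • ξ) q ≠ 0 := fun g =>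
    eval_ne_zero_of_dvd_translate hreg hq0 hq (smul_mem_genericPoints hξ g)
  have hp1 := hpne 1
  have hq1 := hqne 1
  rw [one_smul] at hp1 hq1
  have hval : ∀ g : G, MvPolynomial.eval (g • ξ) p / MvPolynomial.eval (g • ξ) q
      = χ g * (MvPolynomial.eval ξ p / MvPolynomial.eval ξ q) := fun g =>
    h g ξ _ _ (hasValueAt_div hq1) (hasValueAt_div (hqne g))
  have hχ1 : (⟨χ, hχ⟩ : characterGroup G) = 1 := hinj <| by
    rw [map_one]
    refine Subtype.ext (MonoidHom.ext fun k => Units.ext ?_)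
    have hkG : k.1 ∈ G := stab_le G ξ k.2
    have hk : (⟨k.1, hkG⟩ : G) • ξ = ξ := mem_stab_iff.mp k.2
    have := hval ⟨k.1, hkG⟩
    rw [hk] at this
    exact (right_eq_mul₀ (div_ne_zero hp1 hq1)).mp this
  have hχg : ∀ g, χ g = 1 := fun g =>
    congrArg (fun ψ : characterGroup G => ψ.1 g) hχ1
  refine ⟨MvPolynomial.eval ξ p / MvPolynomial.eval ξ q, ?_⟩
  rw [← algebraMap_C_eq, div_eq_iff (algebraMap_rationalFunctions_ne_zero hq0), ← map_mul]
  congr 1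
  refine orbitHom_injective hreg hξ (Subtype.ext (funext fun g => ?_))
  have := hval g
  rw [hχg, Units.val_one, one_mul, div_eq_iff (hqne g)] at this
  rw [orbitHom_apply, orbitHom_apply, map_mul, MvPolynomial.eval_C, this]

/-- If all relative invariants are constant, then restriction of characters to the stabiliser of
a generic point is injective. -/
theorem restrict_injective_of_constant [IsAlgClosed E] [CharZero E]
    (hG : IsConnectedLinearAlgebraicGroup G) (hreg : IsRegularAction (n := n) G)
    {ξ : Fin n → E} (hξ : ξ ∈ genericPoints (n := n) G)
    (hconst : ∀ f : RationalFunctions E n, IsRelativeInvariant G f →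
      ∃ c : E, f = algebraMap E (RationalFunctions E n) c) :
    Function.Injective (restrict (stab_le G ξ)) := by
  have := isDomain_coordRing hG
  have hinj := orbitHom_injective hreg hξ
  rw [injective_iff_map_eq_one]
  rintro ⟨χ, hχ⟩ h1
  have hstab : ∀ k : G, k • ξ = ξ → χ k = 1 := fun k hk => by
    have := congrArg (fun ψ : characterGroup (stab G ξ) => ψ.1 ⟨k.1, mem_stab_iff.mpr hk⟩) h1
    exact this
  let P : coordRing G := ⟨fun g => (χ g : E), mem_coordRing_iff.mpr hχ⟩
  obtain ⟨a, b, ha, hab⟩ := exists_descent hG hreg hξ (P := P) (Q := 1) one_ne_zero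
    fun g k hk => by
      change (χ g : E) * 1 = 1 * (χ (g * k) : E)
      rw [map_mul, hstab k hk, mul_one, mul_one, one_mul]
  rw [mul_one] at hab
  have habg : ∀ g : G, MvPolynomial.eval (g • ξ) a * χ g = MvPolynomial.eval (g • ξ) b := fun g =>
    congrFun (congrArg Subtype.val hab) g
  have ha' : orbitHom hreg ξ a ≠ 0 := (map_ne_zero_iff _ hinj).mpr ha
  have hP : P ≠ 0 := coordRing_ne_zero_iff.mpr ⟨1, (χ 1).ne_zero⟩
  have hb : b ≠ 0 := fun h0 => mul_ne_zero ha' hP (by rw [hab, h0, map_zero])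
  obtain ⟨c, hc⟩ := hconst _ <| isRelativeInvariant_div hreg hb ha hχ fun g =>
    hinj (Subtype.ext (funext fun k => by
      have e1 := habg (g * k)
      have e2 := habg k
      rw [mul_smul, map_mul, Units.val_mul] at e1
      rw [map_mul, map_mul, map_mul]
      change (orbitHom hreg ξ (translate hreg g b)).1 k * (orbitHom hreg ξ a).1 k
        = (orbitHom hreg ξ (MvPolynomial.C (χ g : E))).1 k * (orbitHom hreg ξ b).1 k
          * (orbitHom hreg ξ (translate hreg g a)).1 k
      simp only [orbitHom_apply, eval_translate, MvPolynomial.eval_C]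
      linear_combination (-MvPolynomial.eval (k • ξ) a) * e1
        + (χ g * MvPolynomial.eval (g • k • ξ) a) * e2))
  rw [← algebraMap_C_eq, div_eq_iff (algebraMap_rationalFunctions_ne_zero ha), ← map_mul] at hc
  have hbc : b = MvPolynomial.C c * a := IsFractionRing.injective _ _ hc
  have hPc : P = algebraMap E (coordRing G) c := by
    refine mul_left_cancel₀ ha' ?_
    rw [hab, hbc, map_mul, mul_comm, ← MvPolynomial.algebraMap_eq, AlgHom.commutes]
  have hχc : ∀ g, (χ g : E) = c := fun g => congrFun (congrArg Subtype.val hPc) g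
  refine Subtype.ext (MonoidHom.ext fun g => Units.ext ?_)
  change (χ g : E) = 1
  rw [hχc, ← hχc 1, map_one, Units.val_one]

/-- The set of generic points contains a nonempty basic open set. -/
theorem exists_basicOpen_subset_genericPoints [IsAlgClosed E]
    (hG : IsConnectedLinearAlgebraicGroup G) (hreg : IsRegularAction (n := n) G)
    {ξ : Fin n → E} (hξ : ξ ∈ genericPoints (n := n) G) :
    ∃ a : MvPolynomial (Fin n) E, a ≠ 0 ∧
      ∀ x, MvPolynomial.eval x a ≠ 0 → x ∈ genericPoints (n := n) G := by
  have : Infinite E := IsAlgClosed.instInfinite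
  have := isDomain_coordRing hG
  let : Algebra (MvPolynomial (Fin n) E) (coordRing G) := (orbitHom hreg ξ).toRingHom.toAlgebra
  have : IsScalarTower E (MvPolynomial (Fin n) E) (coordRing G) :=
    IsScalarTower.of_algebraMap_eq fun c => ((orbitHom hreg ξ).commutes c).symm
  obtain ⟨a, ha, h⟩ := exists_ne_zero_forall_algHom_extends (E := E)
    (A := MvPolynomial (Fin n) E) (B := coordRing G) (orbitHom_injective hreg hξ)
  refine ⟨a, ha, fun x hx => ?_⟩
  obtain ⟨ψ, hψ⟩ := h (MvPolynomial.aeval x) (by rwa [MvPolynomial.aeval_eq_eval])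
  obtain ⟨g, hg⟩ := exists_eq_of_algHom hG.isClosed ψ
  have hgx : g • ξ = x := funext fun i => by
    have := hψ (MvPolynomial.X i)
    rw [hg, MvPolynomial.aeval_X] at this
    change MvPolynomial.eval (g • ξ) (MvPolynomial.X i) = x i at this
    rwa [MvPolynomial.eval_X] at this
  exact hgx ▸ smul_mem_genericPoints hξ g

/-- All relative invariants are constant if and only if every hypersurface contains a generic
point. -/
theorem constant_iff_exists_generic_zero [IsAlgClosed E] [CharZero E]
    (hG : IsConnectedLinearAlgebraicGroup G) (hreg : IsRegularAction (n := n) G)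
    {ξ : Fin n → E} (hξ : ξ ∈ genericPoints (n := n) G) :
    (∀ f : RationalFunctions E n, IsRelativeInvariant G f →
      ∃ c : E, f = algebraMap E (RationalFunctions E n) c) ↔
    ∀ π : MvPolynomial (Fin n) E, Prime π →
      ∃ x, MvPolynomial.eval x π = 0 ∧ x ∈ genericPoints (n := n) G := by
  constructor
  · intro hconst π hπ
    by_contra! hsing
    obtain ⟨a, ha, hgen⟩ := exists_basicOpen_subset_genericPoints hG hreg hξ
    have hdvd : ∀ g : G, π ∣ translate hreg g a := fun g => dvd_of_eval_eq_zero hπ fun x hx => by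
      rw [eval_translate]
      by_contra hne
      have := smul_mem_genericPoints (hgen _ hne) g⁻¹
      rw [inv_smul_smul] at this
      exact hsing x hx this
    obtain ⟨N, hN, hgcd⟩ := exists_gcd_of_family fun g : G => translate hreg g a
    have hπN : π ∣ N := by
      simpa using hgcd 1 π fun g => by simpa using hdvd g
    have hN0 : N ≠ 0 := fun h0 => by
      have := hN 1
      rw [h0, zero_dvd_iff] at this
      exact (map_ne_zero_iff _ (translate_injective hreg 1)).mpr ha this
    have hτN : ∀ k : G, translate hreg k N ∣ N := fun k => by
      have : ∀ g : G, translate hreg k N ∣ 1 * translate hreg g a := fun g => by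
        have hg : translate hreg k (translate hreg (g * k⁻¹) a) = translate hreg g a :=
          MvPolynomial.funext fun x => by simp [← mul_smul]
        rw [one_mul, ← hg]
        exact map_dvd _ (hN _)
      simpa using hgcd 1 _ this
    have hNτ : ∀ k : G, N ∣ translate hreg k N := fun k => by
      simpa using map_dvd (translate hreg k) (hτN k⁻¹)
    have hc : ∀ k : G, ∃ c : Eˣ, N * MvPolynomial.C (c : E) = translate hreg k N := fun k => by
      obtain ⟨u, hu⟩ := associated_of_dvd_dvd (hNτ k) (hτN k)
      obtain ⟨r, hr, hur⟩ := MvPolynomial.isUnit_iff_eq_C_of_isReduced.mp u.isUnit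
      exact ⟨hr.unit, by rw [IsUnit.unit_spec, ← hur, hu]⟩
    choose c hc using hc
    have := isDomain_coordRing hG
    obtain ⟨χ, hχ, hχc⟩ := exists_character_of_left_semiinvariant hG
      ((map_ne_zero_iff _ (orbitHom_injective hreg hξ)).mpr hN0) (one_ne_zero (α := coordRing G)) c
      fun b g => by
        have := congrArg (MvPolynomial.eval (g • ξ)) (hc b)
        rw [map_mul, MvPolynomial.eval_C, eval_translate, ← mul_smul] at this
        change 1 * MvPolynomial.eval (g • ξ) N * (c b : E) = MvPolynomial.eval ((b * g) • ξ) N * 1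
        rw [one_mul, mul_one, this]
    obtain ⟨e, he⟩ := hconst _ <| isRelativeInvariant_div hreg hN0 one_ne_zero hχ fun g => by
      rw [map_one, mul_one, mul_one, hχc, ← hc, mul_comm]
    rw [map_one, div_one, ← algebraMap_C_eq] at he
    have hNe : N = MvPolynomial.C e := IsFractionRing.injective _ _ he
    have he0 : e ≠ 0 := fun h0 => hN0 (by rw [hNe, h0, map_zero])
    refine hπ.not_isUnit (isUnit_of_dvd_unit hπN ?_)
    rw [hNe]
    exact (IsUnit.mk0 e he0).map MvPolynomial.C
  · intro hgen f hf
    obtain ⟨p, q, hp0, hq0, rfl, hp, hq⟩ := hf.exists_reduced hreg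
    have hunit : ∀ u : MvPolynomial (Fin n) E, u ≠ 0 → (∀ g : G, u ∣ translate hreg g u) →
        ∃ e : E, u = MvPolynomial.C e := fun u hu0 hu => by
      by_contra hne
      have hnu : ¬ IsUnit u := fun h => by
        obtain ⟨r, -, hr⟩ := MvPolynomial.isUnit_iff_eq_C_of_isReduced.mp h
        exact hne ⟨r, hr⟩
      obtain ⟨π, hπ, k, rfl⟩ := WfDvdMonoid.exists_irreducible_factor hnu hu0
      obtain ⟨x, hx, hxgen⟩ := hgen π hπ.prime
      exact eval_ne_zero_of_dvd_translate hreg hu0 hu hxgen (by rw [map_mul, hx, zero_mul])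
    obtain ⟨e₁, rfl⟩ := hunit p hp0 hp
    obtain ⟨e₂, rfl⟩ := hunit q hq0 hq
    exact ⟨e₁ / e₂, by rw [algebraMap_C_eq, algebraMap_C_eq, map_div₀]⟩

end RelativeInvariants

end Prehomogeneous

theorem mainTheorem9 {E : Type*} [Field E] [IsAlgClosed E] [CharZero E] {m n : ℕ}
    (G : Subgroup (GL (Fin m) E)) (hG : Prehomogeneous.IsConnectedLinearAlgebraicGroup G)
    [MulAction G (Fin n → E)] (hV : Prehomogeneous.IsPrehomogeneousAffineSpace n G) :
    (∀ ξ ∈ Prehomogeneous.genericPoints (n := n) G,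
      Prehomogeneous.IsSpecial n G ↔
        Function.Bijective (Prehomogeneous.restrict (Prehomogeneous.stab_le G ξ))) ∧
    List.TFAE
      [Prehomogeneous.IsSpecial n G,
        1 < Prehomogeneous.codim (Prehomogeneous.genericPoints (n := n) G)ᶜ,
        ∀ f : Prehomogeneous.RationalFunctions E n, Prehomogeneous.IsRelativeInvariant G f →
          ∃ c : E, f = algebraMap E (Prehomogeneous.RationalFunctions E n) c] := by
  have hreg := hV.isRegularAction
  have hbij : ∀ ξ ∈ Prehomogeneous.genericPoints (n := n) G,
      (Function.Bijective (Prehomogeneous.restrict (Prehomogeneous.stab_le G ξ)) ↔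
        ∀ f : Prehomogeneous.RationalFunctions E n, Prehomogeneous.IsRelativeInvariant G f →
          ∃ c : E, f = algebraMap E (Prehomogeneous.RationalFunctions E n) c) := fun ξ hξ =>
    ⟨fun h f hf => Prehomogeneous.constant_of_restrict_injective hreg hξ h.injective hf,
      fun h => ⟨Prehomogeneous.restrict_injective_of_constant hG hreg hξ h,
        Prehomogeneous.restrict_surjective hG hreg hξ⟩⟩
  obtain ⟨ξ₀, hξ₀⟩ := hV.nonempty
  have hspecial : Prehomogeneous.IsSpecial n G ↔
      ∀ f : Prehomogeneous.RationalFunctions E n, Prehomogeneous.IsRelativeInvariant G f →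
        ∃ c : E, f = algebraMap E (Prehomogeneous.RationalFunctions E n) c :=
    ⟨fun ⟨ξ, hξ, h⟩ => (hbij ξ hξ).mp h, fun h => ⟨ξ₀, hξ₀, (hbij ξ₀ hξ₀).mpr h⟩⟩
  refine ⟨fun ξ hξ => hspecial.trans (hbij ξ hξ).symm, ?_⟩
  tfae_have 1 ↔ 3 := hspecial
  have hne : (Prehomogeneous.genericPoints (n := n) G)ᶜ ≠ Set.univ := fun h =>
    Set.notMem_compl_iff.mpr hξ₀ (h ▸ Set.mem_univ ξ₀)
  tfae_have 2 ↔ 3 := by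
    rw [Prehomogeneous.constant_iff_exists_generic_zero hG hreg hξ₀,
      Prehomogeneous.one_lt_codim_iff _ hne]
    simp only [Set.notMem_compl_iff]
  tfae_finish
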